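/- **Spaces.** For $d\in\{2,3\}$ let $\mathscr A_d(n)=(\mathbb R^d)^n$ be the space of open $n$-edge polygons $(e_1,\dots,e_n)$ in $\mathbb R^d$ up to translation, $\mathscr P_d(n)=\{e\in\mathscr A_d(n):\sum_i e_i=0\}$ the linear subspace of closed polygons, and $\operatorname{Arm}_d(n)\subset\mathscr A_d(n)$, $\operatorname{Pol}_d(n)\subset\mathscr P_d(n)$ the subsets of polygons of total length $\sum_i|e_i|=2$. A real function $F$ on $\mathscr A_d(n)$ or $\mathscr P_d(n)$ is scale-invariant if $F(ce)=F(e)$ for all $c>0$ and all $e$. **Hopf map.** Let $\operatorname{Hopf}(q)=\bar q\,\mathbf i\,q$ for $q\in\mathbb H$, an imaginary quaternion, i.e. a vector of $\mathbb R^3$; extend it coordinatewise to $\mathbb H^n\to\mathscr A_3(n)$. It maps $\mathbb R^n\oplus\mathbf j\mathbb R^n$ and $\mathbf i\mathbb R^n\oplus\mathbf k\mathbb R^n$ (each identified with $\mathbb C^n=\mathbb R^{2n}$) to $\mathscr A_2(n)$, with $\mathbb R^2$ the $\mathbf i,\mathbf k$-plane. **Hopf-Gaussian measure $\mathrm H$.**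 On $\mathscr A_3(n)$ it is the pushforward by $\operatorname{Hopf}$ of the standard Gaussian measure on $\mathbb H^n=\mathbb R^{4n}$. On $\mathscr A_2(n)$ it is the pushforward of the probability measure on $(\mathbb R^n\oplus\mathbf j\mathbb R^n)\cup(\mathbf i\mathbb R^n\oplus\mathbf k\mathbb R^n)$ that is one half of the standard Gaussian measure on each piece. On $\mathscr P_d(n)$ it is the subspace measure inherited from $\mathscr A_d(n)$, i.e. $\mathrm H$ conditioned on closure: the weak limit, as $\varepsilon\downarrow0$, of the conditional laws $\mathrm H(\,\cdot\mid |\sum_i e_i|<\varepsilon)$. **Symmetric measure $\sigma$.** It is the pushforward by $\operatorname{Hopf}$ of the invariant probability measure on a model space: for $\operatorname{Arm}_3(n)$ the sphere of radius $\sqrt2$ in $\mathbb H^n$; for $\operatorname{Arm}_2(n)$ the disjoint union of the spheres of radius $\sqrt2$ in $\mathbb R^n\oplus\mathbf j\mathbb R^n$ and $\mathbf i\mathbb R^n\oplus\mathbf k\mathbb R^n$, with mass $\tfrac12$ each; for $\operatorname{Pol}_3(n)$ the Stiefel manifold $V_2(\mathbb C^n)$ of Hermitian orthonormal 2-frames $(u,v)$,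 embedded in $\mathbb H^n$ as $u+v\mathbf j$, with its $U(n)$-invariant (Haar) probability measure; for $\operatorname{Pol}_2(n)$ the disjoint union of the real Stiefel manifold $V_2(\mathbb R^n)\subset\mathbb R^n\oplus\mathbf j\mathbb R^n$ (again $(u,v)\mapsto u+v\mathbf j$) and $\mathbf iV_2(\mathbb R^n)$, each with one half of its $O(n)$-invariant probability measure. **Theorem 2.** Let $d\in\{2,3\}$. 1. Let $n\ge1$ and let $F:\mathscr A_d(n)\to\mathbb R$ be scale-invariant. Then $F$ is $\mathrm H$-integrable if and only if its restriction to $\operatorname{Arm}_d(n)$ is $\sigma$-integrable, and in that case $$E(F;\mathscr A_d(n),\mathrm H)=E(F;\operatorname{Arm}_d(n),\sigma).$$ 2. Let $n\ge3$ (for $d=3$, $n\ge2$ suffices). Then the Hopf-Gaussian measure on $\mathscr P_d(n)$ is well defined (the weak limit exists and is a probability measure on $\mathscr P_d(n)$). If $F:\mathscr P_d(n)\to\mathbb R$ is scale-invariant, then $F$ is $\mathrm H$-integrable if and only if its restriction to $\operatorname{Pol}_d(n)$ is $\sigma$-integrable, and in that case $$E(F;\mathscr P_d(n),\mathrm H)=E(F;\operatorname{Pol}_d(n),\sigma).$$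 -/

import Mathlib

open MeasureTheory ProbabilityTheory Filter Topology
open scoped Quaternion ENNReal BoundedContinuousFunction

noncomputable section

namespace HopfPolygon

/-! ### Polygon spaces -/

/-- Open `n`-edge polygons in `ℝ^d` up to translation, recorded by their edge vectors. -/
abbrev Arms (d n : ℕ) : Type := Fin n → EuclideanSpace ℝ (Fin d)

/-- Closed `n`-edge polygons in `ℝ^d` up to translation: the linear subspace of `Arms d n` on which
the edge vectors sum to zero. -/
def Polygons (d n : ℕ) : Submodule ℝ (Arms d n) where
  carrier := {e | ∑ i, e i = 0}
  add_mem' {a b} ha hb := by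
    change ∑ i, (a + b) i = 0
    simp only [Pi.add_apply, Finset.sum_add_distrib]
    rw [show ∑ i, a i = 0 from ha, show ∑ i, b i = 0 from hb, add_zero]
  zero_mem' := by simp
  smul_mem' c a ha := by
    change ∑ i, (c • a) i = 0
    simp only [Pi.smul_apply, ← Finset.smul_sum]
    rw [show ∑ i, a i = 0 from ha, smul_zero]

/-- Open polygons of total length `2`. -/
def Arm (d n : ℕ) : Set (Arms d n) := {e | ∑ i, ‖e i‖ = 2}

/-- Closed polygons of total length `2`. -/
def Pol (d n : ℕ) : Set (Polygons d n) := {p | ∑ i, ‖(p : Arms d n) i‖ = 2}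

/-- Scale invariance: the value does not change under dilation by a positive factor. -/
def ScaleInvariant {V : Type*} [SMul ℝ V] (F : V → ℝ) : Prop :=
  ∀ c : ℝ, 0 < c → ∀ x : V, F (c • x) = F x

/-! ### The Hopf map -/

/-- The quaternion unit `i`. -/
def qI : ℍ[ℝ] := ⟨0, 1, 0, 0⟩

/-- The Hopf map `q ↦ q̄ i q`; its values are imaginary quaternions. -/
def hopf (q : ℍ[ℝ]) : ℍ[ℝ] := star q * qI * q

lemma hopf_coord (q : ℍ[ℝ]) :
    (hopf q).imI = q.re ^ 2 + q.imI ^ 2 - q.imJ ^ 2 - q.imK ^ 2 ∧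
    (hopf q).imJ = 2 * q.imI * q.imJ - 2 * q.re * q.imK ∧
    (hopf q).imK = 2 * q.re * q.imJ + 2 * q.imI * q.imK := by
  have h0 : qI.re = 0 := rfl
  have h1 : qI.imI = 1 := rfl
  have h2 : qI.imJ = 0 := rfl
  have h3 : qI.imK = 0 := rfl
  refine ⟨?_, ?_, ?_⟩ <;> simp [hopf, h0, h1, h2, h3] <;> ring

/-- The coordinatewise Hopf map `ℍ^n → (ℝ³)^n`, with `ℝ³` the span of `i, j, k`. -/
def hopfSpace {n : ℕ} (q : Fin n → ℍ[ℝ]) : Arms 3 n :=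
  fun m => !₂[(hopf (q m)).imI, (hopf (q m)).imJ, (hopf (q m)).imK]

/-- The coordinatewise Hopf map followed by the coordinates in the plane spanned by `i, k`. It is
applied only to `ℝ^n ⊕ jℝ^n` and `iℝ^n ⊕ kℝ^n`, which the Hopf map sends into that plane. -/
def hopfPlane {n : ℕ} (q : Fin n → ℍ[ℝ]) : Arms 2 n :=
  fun m => !₂[(hopf (q m)).imI, (hopf (q m)).imK]

/-- `ℍ^n` from its real coordinates. -/
def quat {n : ℕ} (x : EuclideanSpace ℝ (Fin n × Fin 4)) : Fin n → ℍ[ℝ] :=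
  fun m => ⟨x (m, 0), x (m, 1), x (m, 2), x (m, 3)⟩

/-- The vector `a + b j` of `ℝ^n ⊕ jℝ^n`. -/
def sheetOne {n : ℕ} (a b : Fin n → ℝ) : Fin n → ℍ[ℝ] := fun m => ⟨a m, 0, b m, 0⟩

/-- The vector `i (a + b j) = a i + b k` of `iℝ^n ⊕ kℝ^n`. -/
def sheetTwo {n : ℕ} (a b : Fin n → ℝ) : Fin n → ℍ[ℝ] := fun m => qI * sheetOne a b m

/-! ### The Hopf-Gaussian measures -/

/-- The Hopf-Gaussian measure on open space polygons: the pushforward by the Hopf map of the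
standard Gaussian measure on `ℍ^n = ℝ^{4n}`. -/
def hopfGaussianSpace (n : ℕ) : Measure (Arms 3 n) :=
  (stdGaussian (EuclideanSpace ℝ (Fin n × Fin 4))).map fun x => hopfSpace (quat x)

/-- The Hopf-Gaussian measure on open planar polygons: the pushforward by the Hopf map of the
probability measure on `(ℝ^n ⊕ jℝ^n) ∪ (iℝ^n ⊕ kℝ^n)` that is half the standard Gaussian measure
of `ℂ^n = ℝ^{2n}` on each of the two pieces. -/
def hopfGaussianPlane (n : ℕ) : Measure (Arms 2 n) :=
  (2⁻¹ : ℝ≥0∞) •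
    ((stdGaussian (EuclideanSpace ℝ (Fin n × Fin 2))).map
        (fun z => hopfPlane (sheetOne (fun m => z (m, 0)) (fun m => z (m, 1)))) +
      (stdGaussian (EuclideanSpace ℝ (Fin n × Fin 2))).map
        (fun z => hopfPlane (sheetTwo (fun m => z (m, 0)) (fun m => z (m, 1)))))

/-- `ν` is the law of a `μ`-random open polygon conditioned on closure: the probability measure on
closed polygons to which the laws `μ( · | ‖e₁ + ⋯ + eₙ‖ < ε)` converge weakly as `ε → 0`. -/
def IsSubspaceMeasure {d n : ℕ} (μ : Measure (Arms d n)) (ν : Measure (Polygons d n)) : Prop :=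
  IsProbabilityMeasure ν ∧
    ∀ f : Arms d n →ᵇ ℝ,
      Tendsto (fun ε : ℝ => ∫ e, f e ∂(cond μ {e : Arms d n | ‖∑ i, e i‖ < ε})) (𝓝[>] 0)
        (𝓝 (∫ p : Polygons d n, f (p : Arms d n) ∂ν))

open Classical in
/-- The subspace measure on closed polygons inherited from `μ` (zero if there is none; there is at
most one). -/
def subspaceMeasure {d n : ℕ} (μ : Measure (Arms d n)) : Measure (Polygons d n) :=
  if h : ∃ ν : Measure (Polygons d n), IsSubspaceMeasure μ ν then h.choose else 0

/-! ### The symmetric measures on open polygons -/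

/-- The uniform probability measure on the unit sphere of `ℝ^ι`. -/
def uniformSphere (ι : Type) [Fintype ι] :
    Measure (Metric.sphere (0 : EuclideanSpace ℝ ι) 1) :=
  ((volume : Measure (EuclideanSpace ℝ ι)).toSphere Set.univ)⁻¹ •
    (volume : Measure (EuclideanSpace ℝ ι)).toSphere

lemma norm_hopfSpace {n : ℕ} (q : Fin n → ℍ[ℝ]) (m : Fin n) :
    ‖hopfSpace q m‖ = (q m).re ^ 2 + (q m).imI ^ 2 + (q m).imJ ^ 2 + (q m).imK ^ 2 := by
  obtain ⟨h1, h2, h3⟩ := hopf_coord (q m)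
  rw [EuclideanSpace.norm_eq, Real.sqrt_eq_iff_mul_self_eq (by positivity) (by positivity)]
  simp [Fin.sum_univ_three, hopfSpace, h1, h2, h3]
  ring

lemma norm_hopfPlane_sheetOne {n : ℕ} (a b : Fin n → ℝ) (m : Fin n) :
    ‖hopfPlane (sheetOne a b) m‖ = a m ^ 2 + b m ^ 2 := by
  obtain ⟨h1, -, h3⟩ := hopf_coord (sheetOne a b m)
  rw [EuclideanSpace.norm_eq, Real.sqrt_eq_iff_mul_self_eq (by positivity) (by positivity)]
  simp only [Fin.sum_univ_two, hopfPlane, h1, h3]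
  simp [sheetOne, mul_pow]
  ring

lemma hopfPlane_sheetTwo {n : ℕ} (a b : Fin n → ℝ) :
    hopfPlane (sheetTwo a b) = hopfPlane (sheetOne a b) := by
  have h : ∀ m, hopf (sheetTwo a b m) = hopf (sheetOne a b m) := by
    intro m
    have hI : star qI * qI = 1 := by
      have h0 : qI.re = 0 := rfl
      have h1 : qI.imI = 1 := rfl
      have h2 : qI.imJ = 0 := rfl
      have h3 : qI.imK = 0 := rfl
      ext <;> simp [h0, h1, h2, h3]
    simp only [hopf, sheetTwo, star_mul]
    rw [mul_assoc (star (sheetOne a b m)), hI, mul_one, ← mul_assoc]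
  funext m
  simp only [hopfPlane, h]

lemma sum_sq_sphere {ι : Type} [Fintype ι] (x : Metric.sphere (0 : EuclideanSpace ℝ ι) 1) :
    ∑ l, ((√2 • (x : EuclideanSpace ℝ ι)) l) ^ 2 = 2 := by
  have h : ‖(x : EuclideanSpace ℝ ι)‖ ^ 2 = 1 := by simp
  rw [EuclideanSpace.norm_sq_eq] at h
  simp only [Real.norm_eq_abs, sq_abs] at h
  simp [mul_pow, ← Finset.mul_sum, h]

/-- The Hopf map from the sphere of radius `√2` in `ℍ^n`, parametrized by the unit sphere, to open
space polygons of length `2`. -/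
def sphereToArmSpace (n : ℕ) (x : Metric.sphere (0 : EuclideanSpace ℝ (Fin n × Fin 4)) 1) :
    Arm 3 n :=
  ⟨hopfSpace (quat (√2 • (x : EuclideanSpace ℝ (Fin n × Fin 4)))), by
    have h := sum_sq_sphere x
    rw [Fintype.sum_prod_type] at h
    change ∑ m, ‖hopfSpace (quat (√2 • (x : EuclideanSpace ℝ (Fin n × Fin 4)))) m‖ = 2
    simpa only [norm_hopfSpace, quat, Fin.sum_univ_four] using h⟩

/-- The Hopf map from the sphere of radius `√2` in `ℝ^n ⊕ jℝ^n` to open planar polygons. -/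
def sphereToArmPlaneOne (n : ℕ)
    (x : Metric.sphere (0 : EuclideanSpace ℝ (Fin n × Fin 2)) 1) : Arm 2 n :=
  ⟨hopfPlane (sheetOne (fun m => (√2 • (x : EuclideanSpace ℝ (Fin n × Fin 2))) (m, 0))
      (fun m => (√2 • (x : EuclideanSpace ℝ (Fin n × Fin 2))) (m, 1))), by
    have h := sum_sq_sphere x
    rw [Fintype.sum_prod_type] at h
    change ∑ m, ‖hopfPlane _ m‖ = 2
    simpa only [norm_hopfPlane_sheetOne, Fin.sum_univ_two] using h⟩

/-- The Hopf map from the sphere of radius `√2` in `iℝ^n ⊕ kℝ^n` to open planar polygons. -/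
def sphereToArmPlaneTwo (n : ℕ)
    (x : Metric.sphere (0 : EuclideanSpace ℝ (Fin n × Fin 2)) 1) : Arm 2 n :=
  ⟨hopfPlane (sheetTwo (fun m => (√2 • (x : EuclideanSpace ℝ (Fin n × Fin 2))) (m, 0))
      (fun m => (√2 • (x : EuclideanSpace ℝ (Fin n × Fin 2))) (m, 1))), by
    rw [hopfPlane_sheetTwo]
    exact (sphereToArmPlaneOne n x).2⟩

/-- The symmetric measure on open space polygons of length `2`. -/
def symmetricArmSpace (n : ℕ) : Measure (Arm 3 n) :=
  (uniformSphere (Fin n × Fin 4)).map (sphereToArmSpace n)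

/-- The symmetric measure on open planar polygons of length `2`: the pushforward of the uniform
probability measure on the disjoint union of two spheres. -/
def symmetricArmPlane (n : ℕ) : Measure (Arm 2 n) :=
  (2⁻¹ : ℝ≥0∞) •
    ((uniformSphere (Fin n × Fin 2)).map (sphereToArmPlaneOne n) +
      (uniformSphere (Fin n × Fin 2)).map (sphereToArmPlaneTwo n))

/-! ### The symmetric measures on closed polygons -/

/-- The Stiefel manifold of (Hermitian) orthonormal 2-frames in `𝕜^n`. -/
def Stiefel (𝕜 : Type) [RCLike 𝕜] (n : ℕ) :
    Set (EuclideanSpace 𝕜 (Fin n) × EuclideanSpace 𝕜 (Fin n)) :=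
  {p | ‖p.1‖ = 1 ∧ ‖p.2‖ = 1 ∧ inner 𝕜 p.1 p.2 = 0}

instance compactSpace_unitaryGroup (𝕜 : Type) [RCLike 𝕜] (n : ℕ) :
    CompactSpace (Matrix.unitaryGroup (Fin n) 𝕜) := by
  refine isCompact_iff_compactSpace.1 (?_ : IsCompact
    (Matrix.unitaryGroup (Fin n) 𝕜 : Set (Matrix (Fin n) (Fin n) 𝕜)))
  have hK : IsCompact (Set.univ.pi fun _ : Fin n => Set.univ.pi fun _ : Fin n =>
      Metric.closedBall (0 : 𝕜) 1) :=
    isCompact_univ_pi fun _ => isCompact_univ_pi fun _ => isCompact_closedBall _ _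
  refine IsCompact.of_isClosed_subset hK (isClosed_unitary (R := Matrix (Fin n) (Fin n) 𝕜)) ?_
  intro U hU
  refine Set.mem_univ_pi.2 fun i => Set.mem_univ_pi.2 fun j => ?_
  rw [Metric.mem_closedBall, dist_zero_right]
  exact entry_norm_bound_of_unitary hU i j

instance measurableSpace_unitaryGroup (𝕜 : Type) [RCLike 𝕜] (n : ℕ) :
    MeasurableSpace (Matrix.unitaryGroup (Fin n) 𝕜) := borel _

instance borelSpace_unitaryGroup (𝕜 : Type) [RCLike 𝕜] (n : ℕ) :
    BorelSpace (Matrix.unitaryGroup (Fin n) 𝕜) := ⟨rfl⟩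

/-- The orbit map `U ↦ (U e₁, U e₂)` from the unitary (orthogonal) group to the Stiefel manifold. -/
def frame (𝕜 : Type) [RCLike 𝕜] {n : ℕ} (hn : 2 ≤ n) (U : Matrix.unitaryGroup (Fin n) 𝕜) :
    Stiefel 𝕜 n :=
  ⟨(WithLp.toLp 2 fun m => (U : Matrix (Fin n) (Fin n) 𝕜) m (Fin.castLE hn 0),
    WithLp.toLp 2 fun m => (U : Matrix (Fin n) (Fin n) 𝕜) m (Fin.castLE hn 1)), by
    have key : ∀ k l : Fin n,
        inner 𝕜 (WithLp.toLp 2 fun m => (U : Matrix (Fin n) (Fin n) 𝕜) m k :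
            EuclideanSpace 𝕜 (Fin n))
          (WithLp.toLp 2 fun m => (U : Matrix (Fin n) (Fin n) 𝕜) m l) =
          (1 : Matrix (Fin n) (Fin n) 𝕜) k l := by
      intro k l
      rw [← Matrix.UnitaryGroup.star_mul_self U]
      simp [PiLp.inner_apply, Matrix.mul_apply, Matrix.star_apply, mul_comm]
    have nrm : ∀ k : Fin n, ‖(WithLp.toLp 2 fun m => (U : Matrix (Fin n) (Fin n) 𝕜) m k :
        EuclideanSpace 𝕜 (Fin n))‖ = 1 := by
      intro k
      rw [norm_eq_sqrt_re_inner (𝕜 := 𝕜), key k k]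
      simp
    refine ⟨nrm _, nrm _, ?_⟩
    rw [key]
    simp [Fin.ext_iff]⟩

/-- The invariant (Haar) probability measure on the Stiefel manifold, a homogeneous space of the
unitary (orthogonal) group. -/
def stiefelHaar (𝕜 : Type) [RCLike 𝕜] {n : ℕ} (hn : 2 ≤ n) : Measure (Stiefel 𝕜 n) :=
  (Measure.haarMeasure (⊤ : TopologicalSpace.PositiveCompacts (Matrix.unitaryGroup (Fin n) 𝕜))).map
    (frame 𝕜 hn)

/-- The vector `u + v j` of `ℍ^n` for `u, v ∈ ℂ^n`. -/
def complexPair {n : ℕ} (u v : EuclideanSpace ℂ (Fin n)) : Fin n → ℍ[ℝ] :=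
  fun m => ⟨(u m).re, (u m).im, (v m).re, (v m).im⟩

lemma stiefel_complex {n : ℕ} (p : Stiefel ℂ n) :
    ∑ m, ((p.1.1 m).re ^ 2 + (p.1.1 m).im ^ 2) = 1 ∧
    ∑ m, ((p.1.2 m).re ^ 2 + (p.1.2 m).im ^ 2) = 1 ∧
    ∑ m, ((p.1.1 m).re * (p.1.2 m).re + (p.1.1 m).im * (p.1.2 m).im) = 0 ∧
    ∑ m, ((p.1.1 m).im * (p.1.2 m).re - (p.1.1 m).re * (p.1.2 m).im) = 0 := by
  obtain ⟨⟨u, v⟩, hu, hv, huv⟩ := p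
  have sq : ∀ w : EuclideanSpace ℂ (Fin n), ‖w‖ = 1 →
      ∑ m, ((w m).re ^ 2 + (w m).im ^ 2) = 1 := by
    intro w hw
    have h := EuclideanSpace.norm_sq_eq w
    rw [hw] at h
    simpa [Complex.sq_norm, Complex.normSq_apply, ← sq] using h.symm
  refine ⟨sq u hu, sq v hv, ?_, ?_⟩
  · have h := congrArg Complex.re huv
    simp only [PiLp.inner_apply, Complex.re_sum] at h
    simpa [mul_comm] using h
  · have h := congrArg Complex.im huv
    simp only [PiLp.inner_apply, Complex.im_sum] at h
    rw [← neg_eq_zero, ← Finset.sum_neg_distrib]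
    refine Eq.trans (Finset.sum_congr rfl fun m _ => ?_) h
    simp
    ring

lemma stiefel_real {n : ℕ} (p : Stiefel ℝ n) :
    ∑ m, (p.1.1 m) ^ 2 = 1 ∧ ∑ m, (p.1.2 m) ^ 2 = 1 ∧ ∑ m, p.1.1 m * p.1.2 m = 0 := by
  obtain ⟨⟨u, v⟩, hu, hv, huv⟩ := p
  have sq : ∀ w : EuclideanSpace ℝ (Fin n), ‖w‖ = 1 → ∑ m, (w m) ^ 2 = 1 := by
    intro w hw
    have h := EuclideanSpace.norm_sq_eq w
    rw [hw] at h
    simpa using h.symm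
  refine ⟨sq u hu, sq v hv, ?_⟩
  simpa [PiLp.inner_apply, mul_comm] using huv

/-- The Hopf map from `V₂(ℂ^n)` to closed space polygons of length `2`. -/
def stiefelToPolSpace (n : ℕ) (p : Stiefel ℂ n) : Pol 3 n :=
  ⟨⟨hopfSpace (complexPair p.1.1 p.1.2), by
    obtain ⟨h1, h2, h3, h4⟩ := stiefel_complex p
    change ∑ m, hopfSpace (complexPair p.1.1 p.1.2) m = 0
    ext l
    fin_cases l
    · refine Eq.trans ?_ (sub_eq_zero.2 (h1.trans h2.symm))
      rw [← Finset.sum_sub_distrib]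
      simp only [WithLp.ofLp_sum, Finset.sum_apply]
      refine Finset.sum_congr rfl fun m _ => ?_
      obtain ⟨c1, c2, c3⟩ := hopf_coord (complexPair p.1.1 p.1.2 m)
      simp only [hopfSpace, c1, c2, c3]
      simp [complexPair]
      ring
    · refine Eq.trans ?_ ((congrArg (fun t : ℝ => 2 * t) h4).trans (mul_zero 2))
      simp only [Finset.mul_sum]
      simp only [WithLp.ofLp_sum, Finset.sum_apply]
      refine Finset.sum_congr rfl fun m _ => ?_
      obtain ⟨c1, c2, c3⟩ := hopf_coord (complexPair p.1.1 p.1.2 m)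
      simp only [hopfSpace, c1, c2, c3]
      simp [complexPair]
      ring
    · refine Eq.trans ?_ ((congrArg (fun t : ℝ => 2 * t) h3).trans (mul_zero 2))
      simp only [Finset.mul_sum]
      simp only [WithLp.ofLp_sum, Finset.sum_apply]
      refine Finset.sum_congr rfl fun m _ => ?_
      obtain ⟨c1, c2, c3⟩ := hopf_coord (complexPair p.1.1 p.1.2 m)
      simp only [hopfSpace, c1, c2, c3]
      simp [complexPair]
      ring⟩, by
    obtain ⟨h1, h2, -, -⟩ := stiefel_complex p
    change ∑ m, ‖hopfSpace (complexPair p.1.1 p.1.2) m‖ = 2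
    refine Eq.trans ?_ ((congrArg₂ (· + ·) h1 h2).trans one_add_one_eq_two)
    simp only [← Finset.sum_add_distrib]
    refine Finset.sum_congr rfl fun m _ => ?_
    rw [norm_hopfSpace]
    simp only [complexPair]
    ring⟩

/-- The Hopf map from `V₂(ℝ^n) ⊆ ℝ^n ⊕ jℝ^n` to closed planar polygons of length `2`. -/
def stiefelToPolPlaneOne (n : ℕ) (p : Stiefel ℝ n) : Pol 2 n :=
  ⟨⟨hopfPlane (sheetOne p.1.1 p.1.2), by
    obtain ⟨h1, h2, h3⟩ := stiefel_real p
    change ∑ m, hopfPlane (sheetOne p.1.1 p.1.2) m = 0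
    ext l
    fin_cases l
    · refine Eq.trans ?_ (sub_eq_zero.2 (h1.trans h2.symm))
      rw [← Finset.sum_sub_distrib]
      simp only [WithLp.ofLp_sum, Finset.sum_apply]
      refine Finset.sum_congr rfl fun m _ => ?_
      obtain ⟨c1, -, c3⟩ := hopf_coord (sheetOne p.1.1 p.1.2 m)
      simp only [hopfPlane, c1, c3]
      simp [sheetOne]
    · refine Eq.trans ?_ ((congrArg (fun t : ℝ => 2 * t) h3).trans (mul_zero 2))
      simp only [Finset.mul_sum]
      simp only [WithLp.ofLp_sum, Finset.sum_apply]
      refine Finset.sum_congr rfl fun m _ => ?_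
      obtain ⟨c1, -, c3⟩ := hopf_coord (sheetOne p.1.1 p.1.2 m)
      simp only [hopfPlane, c1, c3]
      simp [sheetOne]
      ring⟩, by
    obtain ⟨h1, h2, -⟩ := stiefel_real p
    change ∑ m, ‖hopfPlane (sheetOne p.1.1 p.1.2) m‖ = 2
    simp only [norm_hopfPlane_sheetOne, Finset.sum_add_distrib, h1, h2]
    norm_num⟩

/-- The Hopf map from `i V₂(ℝ^n) ⊆ iℝ^n ⊕ kℝ^n` to closed planar polygons of length `2`. -/
def stiefelToPolPlaneTwo (n : ℕ) (p : Stiefel ℝ n) : Pol 2 n :=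
  ⟨⟨hopfPlane (sheetTwo p.1.1 p.1.2), by
    rw [hopfPlane_sheetTwo]
    exact (stiefelToPolPlaneOne n p).1.2⟩, by
    simp only [hopfPlane_sheetTwo]
    exact (stiefelToPolPlaneOne n p).2⟩

/-- The symmetric measure on closed space polygons of length `2`. -/
def symmetricPolSpace {n : ℕ} (hn : 2 ≤ n) : Measure (Pol 3 n) :=
  (stiefelHaar ℂ hn).map (stiefelToPolSpace n)

/-- The symmetric measure on closed planar polygons of length `2`: the pushforward of the invariant
probability measure on the disjoint union of `V₂(ℝ^n)` and `i V₂(ℝ^n)`. -/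
def symmetricPolPlane {n : ℕ} (hn : 2 ≤ n) : Measure (Pol 2 n) :=
  (2⁻¹ : ℝ≥0∞) •
    ((stiefelHaar ℝ hn).map (stiefelToPolPlaneOne n) +
      (stiefelHaar ℝ hn).map (stiefelToPolPlaneTwo n))

end HopfPolygon

end

/-! ### Scale-invariant functions and radial factors -/

namespace HopfPolygon

/-! The Hopf map is homogeneous of degree two. A Gaussian vector is its norm `r` times an
independent uniform direction, so the random open polygon is `r ^ 2 / 2` times an independent
polygon drawn from the symmetric measure. A scale-invariant function does not see the factor, which
settles open polygons (`stdGaussian_eq_map_prod`, `ScaleInvariant.integrable_iff_and_integral_eq`).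

For closed polygons the same factorization has to survive conditioning. Write a point of the model
space as a pair `x = (u, v)` of vectors in `𝕜 ^ n`, with `𝕜 = ℂ` in space and `𝕜 = ℝ` on a sheet of
the planar model, and let `β` be the real dimension of `𝕜`. The length `q = closure2` of the closing
vector is homogeneous of degree two and invariant under the unitary group, and its zero set on the
unit sphere is a single orbit: the orthonormal frames divided by `√2`. Averaging a test function
over the group therefore leaves its integral over `{q < ε}` unchanged and makes it constant on the
zero set at each radius. In polar coordinates the slice of `{q < ε}` at radius `r` is the spherical
set `{q < ε / r ^ 2}`, of mass about `c * (ε / r ^ 2) ^ d` with `d = β + 1`. After division by `ε ^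
d`, dominated convergence gives a limit law: a Haar frame times an independent radius, whose law is
that of the Gaussian norm weighted by `r ^ (-2d)` (`tendsto_setIntegral_stdGaussian_div`,
`exists_tendsto_integral_cond`). The weight is integrable when `2 * (β + 1) < 2 * n * β`, that is `n
≥ 2` in space and `n ≥ 3` in the plane.

The spherical mass comes from an exact law. The quantity `1 - q ^ 2 / ‖x‖ ^ 4` is four times the
Gram determinant of `(u, v)` divided by `‖x‖ ^ 4`. The Gram determinant is `‖u‖ ^ 2 * ‖P v‖ ^ 2`
with `P` the projection orthogonal to `u`, so its moments are products of Gamma quotients; the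
duplication formula turns the moments of the normalized determinant into those of a beta law with
parameters `(n - 1) * β / 2` and `(β + 1) / 2` (`map_stdGaussian_eq_betaMeasure`). Its mass within
`δ ^ 2` of `1` is of order `δ ^ (β + 1)` (`tendsto_stdGaussian_closure2_div`). -/

/-- A scale-invariant function has the same integrability and integral for the law of `t • p`, with
`t > 0` independent of `p`, as for the law of `p`, when `p` lives on a level set of a gauge. -/
theorem ScaleInvariant.integrable_iff_and_integral_eq {V : Type*} [AddCommGroup V] [Module ℝ V]
    [MeasurableSpace V] [MeasurableSMul₂ ℝ V] {S : Set V} (hS : MeasurableSet S)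
    {σ : Measure S} [SFinite σ] {τ : Measure ℝ} [IsProbabilityMeasure τ] (hτ : ∀ᵐ t ∂τ, 0 < t)
    {len : V → ℝ} (hlen : Measurable len) (hsmul : ∀ t : ℝ, 0 < t → ∀ x, len (t • x) = t * len x)
    (hlenS : ∀ x ∈ S, len x = 2) {H : Measure V}
    (hH : H = (σ.prod τ).map fun p : S × ℝ => p.2 • (p.1 : V))
    {F : V → ℝ} (hF : ScaleInvariant F) :
    (Integrable F H ↔ Integrable (fun x : S => F x) σ) ∧ ∫ x, F x ∂H = ∫ x : S, F x ∂σ := by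
  have hM : Measurable fun p : S × ℝ => p.2 • (p.1 : V) :=
    measurable_snd.smul (measurable_subtype_coe.comp measurable_fst)
  have hpos : ∀ᵐ p : S × ℝ ∂(σ.prod τ), 0 < p.2 := Measure.quasiMeasurePreserving_snd.ae hτ
  -- Dilation to length 2. It carries `H` to the image of `σ` and preserves `F` wherever `len` is
  -- positive, hence `H`-almost everywhere.
  let N : V → V := fun x => (2 / len x) • x
  have hN : Measurable N := (measurable_const.div hlen).smul measurable_id
  have hmapN : H.map N = σ.map Subtype.val := by
    rw [hH, Measure.map_map hN hM]
    have h1 : (N ∘ fun p : S × ℝ => p.2 • (p.1 : V)) =ᵐ[σ.prod τ] fun p => (p.1 : V) := by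
      filter_upwards [hpos] with p hp
      simp only [N, Function.comp_apply, hsmul _ hp, hlenS _ p.1.2, smul_smul]
      rw [show 2 / (p.2 * 2) * p.2 = 1 by field_simp, one_smul]
    rw [Measure.map_congr h1]
    change (σ.prod τ).map (Subtype.val ∘ Prod.fst) = _
    rw [← Measure.map_map measurable_subtype_coe measurable_fst, Measure.map_fst_prod]
    simp
  have hlenpos : ∀ᵐ x ∂H, 0 < len x := by
    rw [hH, ae_map_iff hM.aemeasurable (measurableSet_lt measurable_const hlen)]
    filter_upwards [hpos] with p hp
    rw [hsmul _ hp, hlenS _ p.1.2]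
    positivity
  have hFN : F ∘ N =ᵐ[H] F := by
    filter_upwards [hlenpos] with x hx
    exact hF _ (by positivity) x
  have hS' := MeasurableEmbedding.subtype_coe hS
  have hback : Integrable (fun x : S => F x) σ → Integrable F H := by
    intro h
    have h2 : Integrable F (H.map N) := by
      rw [hmapN]; exact (hS'.integrable_map_iff).2 h
    exact (h2.comp_measurable hN).congr hFN
  -- `F` is not assumed measurable, so measurability along `σ` cannot be read off from `F ∘ N`. On
  -- the product, however, the integrand does not involve `t`, and almost every section of an
  -- integrable function is integrable.
  have hforw : Integrable F H → Integrable (fun x : S => F x) σ := by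
    intro h
    rw [hH] at h
    have h1 := h.comp_measurable hM
    have h2 : Integrable (fun p : S × ℝ => F p.1) (σ.prod τ) := by
      refine h1.congr ?_
      filter_upwards [hpos] with p hp
      exact hF _ hp _
    obtain ⟨t, ht⟩ := h2.prod_left_ae.exists
    exact ht
  refine ⟨⟨hforw, hback⟩, ?_⟩
  by_cases h : Integrable (fun x : S => F x) σ
  · have h2 : Integrable F (H.map N) := by
      rw [hmapN]; exact (hS'.integrable_map_iff).2 h
    rw [← integral_congr_ae hFN]
    change ∫ x, F (N x) ∂H = _
    rw [← integral_map hN.aemeasurable h2.1, hmapN, hS'.integral_map]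
  -- Neither side is integrable, and both integrals take the default value 0.
  · rw [integral_undef h, integral_undef fun h' => h (hforw h')]

/-! ### Density, polar decomposition and radial moments of the standard Gaussian measure -/

section Gaussian

variable (E : Type*) [NormedAddCommGroup E] [InnerProductSpace ℝ E]

/-- The normalizing constant of the standard Gaussian density. -/
noncomputable def gaussianConst : ℝ := (2 * Real.pi) ^ (-(Module.finrank ℝ E : ℝ) / 2)

lemma gaussianConst_pos : 0 < gaussianConst E := by unfold gaussianConst; positivity

variable [FiniteDimensional ℝ E] [MeasurableSpace E] [BorelSpace E]

lemma integrable_exp_neg_norm_sq : Integrable fun x : E => Real.exp (-‖x‖ ^ 2 / 2) := by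
  have h := GaussianFourier.integrable_cexp_neg_mul_sq_norm_add (V := E) (b := 1 / 2) (by norm_num)
    0 0
  have h2 := h.norm
  refine h2.congr (Eventually.of_forall fun x => ?_)
  simp only [Complex.norm_exp]
  congr 1
  simp [← Complex.ofReal_pow]
  ring

/-- The Fourier transform of `exp (-‖x‖ ^ 2 / 2)` is a multiple of `exp (-‖t‖ ^ 2 / 2)`, and finite
measures with equal characteristic functions coincide; `gaussianConst` is the factor that makes the
multiple equal to 1. -/
theorem stdGaussian_eq_withDensity :
    stdGaussian E = (volume : Measure E).withDensity
      fun x => ENNReal.ofReal (gaussianConst E * Real.exp (-‖x‖ ^ 2 / 2)) := by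
  have hInt : Integrable fun x : E => gaussianConst E * Real.exp (-‖x‖ ^ 2 / 2) :=
    (integrable_exp_neg_norm_sq E).const_mul _
  have : IsFiniteMeasure ((volume : Measure E).withDensity
      fun x => ENNReal.ofReal (gaussianConst E * Real.exp (-‖x‖ ^ 2 / 2))) :=
    isFiniteMeasure_withDensity_ofReal hInt.2
  apply Measure.ext_of_charFun
  ext t
  rw [charFun_stdGaussian, charFun_apply, integral_withDensity_eq_integral_toReal_smul
    (by fun_prop) (by simp)]
  have h := GaussianFourier.integral_cexp_neg_mul_sq_norm_add (V := E) (b := 1 / 2) (by norm_num)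
    Complex.I t
  have h1 : ∀ x : E, (ENNReal.ofReal (gaussianConst E * Real.exp (-‖x‖ ^ 2 / 2))).toReal •
      Complex.exp ((inner ℝ x t : ℝ) * Complex.I) = (gaussianConst E : ℂ) *
        Complex.exp (-(1 / 2) * (‖x‖ : ℂ) ^ 2 + Complex.I * (inner ℝ t x : ℝ)) := by
    intro x
    rw [ENNReal.toReal_ofReal (by have := gaussianConst_pos E; positivity), Complex.real_smul,
      Complex.exp_add, real_inner_comm]
    push_cast
    rw [mul_assoc, mul_comm Complex.I]
    congr 3
    ring
  simp_rw [h1]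
  rw [integral_const_mul, h]
  rw [show Complex.I ^ 2 * (‖t‖ : ℂ) ^ 2 / (4 * (1 / 2)) = -(‖t‖ : ℂ) ^ 2 / 2 by
    rw [Complex.I_sq]; ring]
  rw [← mul_assoc]
  have h2 : (gaussianConst E : ℂ) * ((Real.pi : ℂ) / (1 / 2)) ^ ((Module.finrank ℝ E : ℂ) / 2) = 1 := by
    rw [show (Real.pi : ℂ) / (1 / 2) = ((2 * Real.pi : ℝ) : ℂ) by push_cast; ring,
      show ((Module.finrank ℝ E : ℂ) / 2) = (((Module.finrank ℝ E : ℝ) / 2 : ℝ) : ℂ) by push_cast; ring,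
      ← Complex.ofReal_cpow (by positivity), ← Complex.ofReal_mul, gaussianConst,
      ← Real.rpow_add (by positivity)]
    ring_nf
    simp
  rw [h2, one_mul]

lemma withDensity_comp_map {α β : Type*} [MeasurableSpace α] [MeasurableSpace β] {κ : Measure α}
    {M : α → β} (hM : Measurable M) {D : β → ℝ≥0∞} (hD : Measurable D) :
    (κ.map M).withDensity D = (κ.withDensity (D ∘ M)).map M := by
  ext s hs
  rw [withDensity_apply _ hs, Measure.map_apply hM hs, withDensity_apply _ (hM hs),
    setLIntegral_map hs hD hM]
  rfl

/-- Polar coordinates are a homeomorphism only off the origin; the origin is null because the space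
is nontrivial. -/
lemma volume_eq_map_toSphere_prod [Nontrivial E] :
    (volume : Measure E) = ((volume : Measure E).toSphere.prod
      (Measure.volumeIoiPow (Module.finrank ℝ E - 1))).map
        fun p => (p.2 : ℝ) • (p.1 : E) := by
  have h := (volume : Measure E).measurePreserving_homeomorphUnitSphereProd
  have h1 : ((homeomorphUnitSphereProd E).toMeasurableEquiv.symm :
      Metric.sphere (0 : E) 1 × Set.Ioi (0 : ℝ) → ({0}ᶜ : Set E)) =
      (homeomorphUnitSphereProd E).symm := rfl
  have h2 := (MeasurePreserving.symm (homeomorphUnitSphereProd E).toMeasurableEquiv h).map_eq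
  have h3 : (fun p : Metric.sphere (0 : E) 1 × Set.Ioi (0 : ℝ) => (p.2 : ℝ) • (p.1 : E)) =
      Subtype.val ∘ (homeomorphUnitSphereProd E).toMeasurableEquiv.symm := by
    funext p
    rw [h1]
    simp
  rw [h3, ← Measure.map_map measurable_subtype_coe (MeasurableEquiv.measurable _), h2,
    (MeasurableEmbedding.subtype_coe (measurableSet_singleton _).compl).map_comap,
    Subtype.range_coe, restrict_compl_singleton]

/-- The uniform probability measure on the unit sphere. -/
noncomputable def sphereProb : Measure (Metric.sphere (0 : E) 1) :=
  ((volume : Measure E).toSphere Set.univ)⁻¹ • (volume : Measure E).toSphere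

instance [Nontrivial E] : IsProbabilityMeasure (sphereProb E) where
  measure_univ := by
    rw [sphereProb, Measure.smul_apply, smul_eq_mul]
    refine ENNReal.inv_mul_cancel ?_ (measure_ne_top _ _)
    rw [Ne, Measure.measure_univ_eq_zero]
    exact Measure.toSphere_ne_zero _

/-- Polar decomposition: under the standard Gaussian measure the direction is uniform on the unit
sphere and independent of the norm. -/
theorem stdGaussian_eq_map_prod [Nontrivial E] :
    stdGaussian E = ((sphereProb E).prod ((stdGaussian E).map norm)).map
      fun p => p.2 • (p.1 : E) := by
  set T := (volume : Measure E).toSphere with hT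
  have hc0 : T Set.univ ≠ 0 := by
    rw [Ne, Measure.measure_univ_eq_zero]
    exact Measure.toSphere_ne_zero _
  have hTσ : T = T Set.univ • sphereProb E := by
    rw [sphereProb, smul_smul, ENNReal.mul_inv_cancel hc0 (measure_ne_top _ _), one_smul]
  let g : Set.Ioi (0 : ℝ) → ℝ≥0∞ := fun r =>
    ENNReal.ofReal (gaussianConst E * Real.exp (-(r : ℝ) ^ 2 / 2))
  have hg : Measurable g := by fun_prop
  let ρ0 := (Measure.volumeIoiPow (Module.finrank ℝ E - 1)).withDensity g
  -- The total mass of the sphere is moved into the radial factor, so that the spherical factor is a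
  -- probability measure.
  let ρ : Measure ℝ := T Set.univ • ρ0.map Subtype.val
  have hM : Measurable fun p : Metric.sphere (0 : E) 1 × ℝ => p.2 • (p.1 : E) := by fun_prop
  have hM' : Measurable fun p : Metric.sphere (0 : E) 1 × Set.Ioi (0 : ℝ) =>
    (p.2 : ℝ) • (p.1 : E) := by fun_prop
  have h1 : stdGaussian E = ((sphereProb E).prod ρ).map fun p => p.2 • (p.1 : E) := by
    have hD : Measurable fun x : E =>
      ENNReal.ofReal (gaussianConst E * Real.exp (-‖x‖ ^ 2 / 2)) := by fun_prop
    have e1 : stdGaussian E = (T.prod ρ0).map fun p => (p.2 : ℝ) • (p.1 : E) := by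
      rw [stdGaussian_eq_withDensity]
      conv_lhs => rw [volume_eq_map_toSphere_prod]
      rw [withDensity_comp_map hM' hD]
      congr 1
      change _ = T.prod (Measure.withDensity _ g)
      rw [prod_withDensity_right hg]
      congr 1
      funext p
      simp [g, norm_smul]
    rw [e1, show T.prod ρ0 = (sphereProb E).prod (T Set.univ • ρ0) by
      conv_lhs => rw [hTσ]
      rw [Measure.prod_smul_left, Measure.prod_smul_right]]
    have e2 : ρ = (T Set.univ • ρ0).map Subtype.val := by
      rw [Measure.map_smul]
    have e3 : (sphereProb E).prod ρ =
        ((sphereProb E).prod (T Set.univ • ρ0)).map (Prod.map id Subtype.val) := by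
      rw [e2, ← Measure.map_prod_map _ _ measurable_id measurable_subtype_coe, Measure.map_id]
    rw [e3, Measure.map_map hM (by fun_prop)]
    rfl
  -- The radial factor need not be computed: pushing the decomposition forward by the norm returns
  -- it, since the spherical factor has mass 1.
  have h2 : (stdGaussian E).map norm = ρ := by
    rw [h1, Measure.map_map measurable_norm hM]
    have h3 : (norm ∘ fun p : Metric.sphere (0 : E) 1 × ℝ => p.2 • (p.1 : E)) =
        (fun r : ℝ => |r|) ∘ Prod.snd := by
      funext p
      simp [norm_smul]
    rw [h3, ← Measure.map_map (by fun_prop) measurable_snd, Measure.map_snd_prod]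
    simp only [measure_univ, one_smul]
    have h4 : (fun r : ℝ => |r|) =ᵐ[ρ] id := by
      refine Measure.ae_smul_measure ?_ _
      change ∀ᵐ r ∂(ρ0.map Subtype.val), |r| = id r
      rw [ae_map_iff measurable_subtype_coe.aemeasurable
        (measurableSet_eq_fun (by fun_prop) measurable_id)]
      exact Eventually.of_forall fun r => abs_of_pos r.2
    rw [Measure.map_congr h4, Measure.map_id]
  rw [h2]
  exact h1

lemma ae_norm_pos [Nontrivial E] : ∀ᵐ r ∂((stdGaussian E).map norm), 0 < r := by
  rw [ae_map_iff measurable_norm.aemeasurable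
    (show MeasurableSet {r : ℝ | 0 < r} from measurableSet_Ioi)]
  have h : ∀ᵐ x ∂(volume : Measure E), 0 < ‖x‖ := by
    filter_upwards [(Set.finite_singleton (0 : E)).countable.ae_notMem volume] with x hx
    exact norm_pos_iff.2 hx
  rw [stdGaussian_eq_withDensity]
  exact (withDensity_absolutelyContinuous _ _).ae_le h

/-- Radial integration turns the moment into a Gamma integral times a constant independent of `s`.
-/
theorem integrable_and_integral_norm_rpow [Nontrivial E] {s : ℝ}
    (hs : -(Module.finrank ℝ E : ℝ) < s) :
    Integrable (fun x : E => ‖x‖ ^ s) (stdGaussian E) ∧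
    ∫ x : E, ‖x‖ ^ s ∂(stdGaussian E) = 2 ^ (s / 2) *
      Real.Gamma ((Module.finrank ℝ E + s) / 2) / Real.Gamma (Module.finrank ℝ E / 2) := by
  set N := Module.finrank ℝ E with hN
  have hN0 : 0 < N := Module.finrank_pos
  have hc := gaussianConst_pos E
  have key : ∀ s : ℝ, -(N : ℝ) < s → Integrable (fun x : E => ‖x‖ ^ s) (stdGaussian E) ∧
      ∫ x : E, ‖x‖ ^ s ∂(stdGaussian E) = (gaussianConst E * N *
        (volume : Measure E).real (Metric.ball 0 1)) *
        ((1 / 2) ^ (-(N + s) / 2) * (1 / 2) * Real.Gamma ((N + s) / 2)) := by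
    intro s hs
    have hpt : ∀ y ∈ Set.Ioi (0 : ℝ), y ^ (N - 1) • ((gaussianConst E * Real.exp (-y ^ 2 / 2)) * y ^ s) =
        gaussianConst E * (y ^ ((N : ℝ) - 1 + s) * Real.exp (-(1 / 2) * y ^ (2 : ℝ))) := by
      intro y hy
      have : (y : ℝ) ^ (N - 1) = y ^ ((N : ℝ) - 1) := by
        rw [← Real.rpow_natCast, Nat.cast_sub hN0]; simp
      rw [smul_eq_mul, this, Real.rpow_add hy, Real.rpow_two,
        show -(1 / 2) * y ^ 2 = -y ^ 2 / 2 by ring]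
      ring
    have hI : Integrable (fun x : E => (gaussianConst E * Real.exp (-‖x‖ ^ 2 / 2)) * ‖x‖ ^ s)
        volume := by
      rw [integrable_fun_norm_addHaar (μ := (volume : Measure E))
        (f := fun y => (gaussianConst E * Real.exp (-y ^ 2 / 2)) * y ^ s),
        integrableOn_congr_fun hpt measurableSet_Ioi]
      exact (integrableOn_rpow_mul_exp_neg_mul_rpow (by linarith) two_pos (by norm_num)).const_mul _
    have hsm : ∀ x : E, (ENNReal.ofReal (gaussianConst E * Real.exp (-‖x‖ ^ 2 / 2))).toReal •
        ‖x‖ ^ s = (gaussianConst E * Real.exp (-‖x‖ ^ 2 / 2)) * ‖x‖ ^ s := fun x => by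
      rw [ENNReal.toReal_ofReal (by positivity), smul_eq_mul]
    rw [stdGaussian_eq_withDensity]
    constructor
    · rw [integrable_withDensity_iff_integrable_smul' (by fun_prop) (by simp)]
      simp_rw [hsm]
      exact hI
    · rw [integral_withDensity_eq_integral_toReal_smul (by fun_prop) (by simp)]
      simp_rw [hsm]
      rw [integral_fun_norm_addHaar (volume : Measure E)
        (fun y => (gaussianConst E * Real.exp (-y ^ 2 / 2)) * y ^ s),
        setIntegral_congr_fun measurableSet_Ioi hpt, integral_const_mul,
        integral_rpow_mul_exp_neg_mul_rpow two_pos (by linarith) (by norm_num), ← hN]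
      simp only [nsmul_eq_mul, smul_eq_mul]
      rw [show (N : ℝ) - 1 + s + 1 = N + s by ring]
      ring
  refine ⟨(key s hs).1, ?_⟩
  -- The case `s = 0` says that the total mass is 1; dividing by it removes the ball volume and the
  -- Gaussian constant.
  have h0 := (key 0 (by simpa using hN0)).2
  simp only [Real.rpow_zero, integral_const, probReal_univ, smul_eq_mul, add_zero] at h0
  rw [(key s hs).2]
  have hG : Real.Gamma ((N : ℝ) / 2) ≠ 0 := (Real.Gamma_pos_of_pos (by positivity)).ne'
  have e : ((1 : ℝ) / 2) ^ (-((N : ℝ) + s) / 2) = (1 / 2) ^ (-(N : ℝ) / 2) * 2 ^ (s / 2) := by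
    rw [show -((N : ℝ) + s) / 2 = -(N : ℝ) / 2 + -(s / 2) by ring, Real.rpow_add (by norm_num),
      one_div, Real.inv_rpow (by norm_num) (-(s / 2)), Real.rpow_neg (by norm_num), inv_inv]
  rw [e, eq_div_iff hG]
  linear_combination -(2 : ℝ) ^ (s / 2) * Real.Gamma ((N + s) / 2) * h0

end Gaussian

/-! ### Averages of test functions over a group action -/

section Average

variable {G E : Type*} [MeasurableSpace G] [NormedAddCommGroup E]

lemma abs_average_le {η : Measure G} [IsProbabilityMeasure η] {act : G → E → E} (h : E →ᵇ ℝ)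
    (x : E) : |∫ g, h (act g x) ∂η| ≤ ‖h‖ := by
  have := norm_integral_le_of_norm_le_const (μ := η) (f := fun g => h (act g x))
    (Eventually.of_forall fun g => h.norm_coe_le_norm _)
  simpa using this

variable [TopologicalSpace G] [BorelSpace G]

lemma continuous_average {η : Measure G} [IsProbabilityMeasure η] {act : G → E → E}
    (hact : Continuous fun p : G × E => act p.1 p.2) (h : E →ᵇ ℝ) :
    Continuous fun x => ∫ g, h (act g x) ∂η := by
  refine continuous_of_dominated (bound := fun _ => ‖h‖) (fun x => ?_) (fun x => ?_)
    (integrable_const _) (Eventually.of_forall fun g => ?_)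
  · exact (h.continuous.comp (hact.comp (by fun_prop : Continuous fun g : G => (g, x))))
      |>.measurable.aestronglyMeasurable
  · exact Eventually.of_forall fun g => h.norm_coe_le_norm _
  · exact h.continuous.comp (hact.comp (by fun_prop : Continuous fun x : E => (g, x)))

/-- After Fubini, the integral for each fixed `g` is independent of `g`, because both the measure
and the set are invariant. -/
lemma setIntegral_average [InnerProductSpace ℝ E] [FiniteDimensional ℝ E] [MeasurableSpace E]
    [BorelSpace E] {η : Measure G} [IsProbabilityMeasure η] {act : G → E → E}
    (hact : Continuous fun p : G × E => act p.1 p.2) {μ : Measure E} [IsProbabilityMeasure μ]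
    (hmp : ∀ g, μ.map (act g) = μ) {s : Set E} (hs : MeasurableSet s)
    (hinv : ∀ g x, act g x ∈ s ↔ x ∈ s) (h : E →ᵇ ℝ) :
    ∫ x in s, ∫ g, h (act g x) ∂η ∂μ = ∫ x in s, h x ∂μ := by
  have hg : ∀ g, Measurable (act g) := fun g =>
    (hact.comp (by fun_prop : Continuous fun x : E => (g, x))).measurable
  have h1 : ∀ g, ∫ x in s, h (act g x) ∂μ = ∫ x in s, h x ∂μ := by
    intro g
    conv_rhs => rw [← hmp g]
    rw [setIntegral_map hs h.continuous.measurable.aestronglyMeasurable (hg g).aemeasurable]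
    congr 2
    ext x
    exact (hinv g x).symm
  rw [integral_integral_swap]
  · simp [h1]
  · have hc : Continuous fun p : E × G => h (act p.2 p.1) :=
      h.continuous.comp (hact.comp (by fun_prop : Continuous fun p : E × G => (p.2, p.1)))
    exact Integrable.of_bound hc.measurable.aestronglyMeasurable ‖h‖
      (Eventually.of_forall fun p => h.norm_coe_le_norm _)

end Average

/-! ### Conditioning a Gaussian vector on a small homogeneous function -/

section Limit

variable {E : Type*} [NormedAddCommGroup E] [InnerProductSpace ℝ E] [FiniteDimensional ℝ E]
  [MeasurableSpace E] [BorelSpace E]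

/-- The set is a cone, so membership depends on the direction only. This carries the mass
asymptotics from the Gaussian measure, where they are computed, to the sphere, where they are used.
-/
lemma stdGaussian_real_lt_mul_norm_sq [Nontrivial E] {q : E → ℝ} (hq : Continuous q)
    (hq2 : ∀ (r : ℝ) x, q (r • x) = r ^ 2 * q x) (δ : ℝ) :
    (stdGaussian E).real {x | q x < δ * ‖x‖ ^ 2} =
      (sphereProb E).real {x | q (x : E) < δ} := by
  have hM : Measurable fun p : Metric.sphere (0 : E) 1 × ℝ => p.2 • (p.1 : E) := by fun_prop
  have hs : MeasurableSet {x : E | q x < δ * ‖x‖ ^ 2} :=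
    measurableSet_lt hq.measurable (by fun_prop)
  have hs' : MeasurableSet {x : Metric.sphere (0 : E) 1 | q (x : E) < δ} :=
    measurableSet_lt (hq.measurable.comp measurable_subtype_coe) measurable_const
  have hρ : IsProbabilityMeasure ((stdGaussian E).map norm) :=
    Measure.isProbabilityMeasure_map measurable_norm.aemeasurable
  have h : (stdGaussian E) {x | q x < δ * ‖x‖ ^ 2} =
      (sphereProb E) {x | q (x : E) < δ} := by
    conv_lhs => rw [stdGaussian_eq_map_prod, Measure.map_apply hM hs]
    have h1 : ((fun p : Metric.sphere (0 : E) 1 × ℝ => p.2 • (p.1 : E)) ⁻¹'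
        {x | q x < δ * ‖x‖ ^ 2}) =ᵐ[(sphereProb E).prod ((stdGaussian E).map norm)]
        (Prod.fst ⁻¹' {x : Metric.sphere (0 : E) 1 | q (x : E) < δ}) := by
      filter_upwards [Measure.quasiMeasurePreserving_snd.ae (ae_norm_pos E)] with p hp
      apply propext
      change q (p.2 • (p.1 : E)) < δ * ‖p.2 • (p.1 : E)‖ ^ 2 ↔ q (p.1 : E) < δ
      have hp2 : 0 < p.2 ^ 2 := by positivity
      rw [hq2, norm_smul]
      simp only [norm_eq_of_mem_sphere, mul_one, Real.norm_eq_abs, sq_abs]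
      rw [mul_comm δ, mul_lt_mul_iff_right₀ hp2]
    rw [measure_congr h1, ← Measure.map_apply measurable_fst hs', Measure.map_fst_prod]
    simp
  simp only [Measure.real, h]

/-- The factor `r ^ (dim - 1)` of polar coordinates absorbs the singularity at the origin. The
dimension restriction on closed polygons enters here. -/
lemma integrable_norm_pow_inv [Nontrivial E] {k : ℕ} (hk : k < Module.finrank ℝ E) :
    Integrable (fun r : ℝ => (r ^ k)⁻¹) ((stdGaussian E).map norm) := by
  have h := (integrable_and_integral_norm_rpow E (s := -(k : ℝ)) (by simpa using hk)).1
  have h2 : Integrable (fun r : ℝ => r ^ (-(k : ℝ))) ((stdGaussian E).map norm) := by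
    rw [integrable_map_measure (by fun_prop) measurable_norm.aemeasurable]
    exact h
  refine h2.congr ?_
  filter_upwards [ae_norm_pos E] with r hr
  rw [Real.rpow_neg hr.le, Real.rpow_natCast]

/-- The limit controls `m` only near 0; from some `δ0` on, the bound `m ≤ 1` takes over. A bound for
all `δ` is needed for domination, because `ε / r ^ 2` is large when `r` is small. -/
lemma exists_le_mul_pow {m : ℝ → ℝ} (hm1 : ∀ δ, m δ ≤ 1) {d : ℕ} {c : ℝ} (hc : 0 < c)
    (hm : Tendsto (fun δ => m δ / δ ^ d) (𝓝[>] 0) (𝓝 c)) :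
    ∃ C, 0 < C ∧ ∀ δ, 0 < δ → m δ ≤ C * δ ^ d := by
  have h1 : ∀ᶠ δ in 𝓝[>] 0, m δ / δ ^ d < c + 1 := hm.eventually (gt_mem_nhds (by linarith))
  obtain ⟨δ0, hδ0, h2⟩ := (mem_nhdsGT_iff_exists_Ioo_subset).1 h1
  have hδ0 : 0 < δ0 := hδ0
  refine ⟨max (c + 1) (1 / δ0 ^ d), lt_max_of_lt_left (by linarith), fun δ hδ => ?_⟩
  have hδd : 0 < δ ^ d := by positivity
  by_cases hlt : δ < δ0
  · have h3 : m δ / δ ^ d < c + 1 := h2 ⟨hδ, hlt⟩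
    rw [div_lt_iff₀ hδd] at h3
    exact h3.le.trans (by gcongr; exact le_max_left _ _)
  · have h4 : δ0 ^ d ≤ δ ^ d := by gcongr; linarith
    calc m δ ≤ 1 := hm1 δ
      _ = 1 / δ0 ^ d * δ0 ^ d := by field_simp
      _ ≤ max (c + 1) (1 / δ0 ^ d) * δ ^ d := by
        gcongr
        exact le_max_right _ _

/-- On the unit sphere, the integral of a continuous function over `{q < δ}` behaves like the
measure of that set times the common value of the function on `{q = 0}`. -/
lemma tendsto_setIntegral_sphere_div {q : E → ℝ} (hq : Continuous q) (hq0 : ∀ x, 0 ≤ q x)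
    {σ : Measure (Metric.sphere (0 : E) 1)} [IsProbabilityMeasure σ] {f : E → ℝ}
    (hf : Continuous f) {A : ℝ}
    (hA : ∀ x, ‖x‖ = 1 → q x = 0 → f x = A) {d : ℕ} {c : ℝ}
    (hm : Tendsto (fun δ => σ.real {x | q (x : E) < δ} / δ ^ d) (𝓝[>] 0) (𝓝 c)) :
    Tendsto (fun δ => (∫ x in {x | q (x : E) < δ}, f (x : E) ∂σ) / δ ^ d) (𝓝[>] 0)
      (𝓝 (c * A)) := by
  have hfc : Continuous fun x : Metric.sphere (0 : E) 1 => f x := hf.comp continuous_subtype_val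
  have hInt : Integrable (fun x : Metric.sphere (0 : E) 1 => f x) σ := by
    obtain ⟨B, hB⟩ := (isCompact_range hfc).isBounded.exists_norm_le
    exact Integrable.of_bound hfc.measurable.aestronglyMeasurable B
      (Eventually.of_forall fun x => hB _ ⟨x, rfl⟩)
  have hsm : ∀ δ, MeasurableSet {x : Metric.sphere (0 : E) 1 | q (x : E) < δ} := fun δ =>
    measurableSet_lt (hq.measurable.comp measurable_subtype_coe) measurable_const
  have hclose : ∀ η > 0, ∀ᶠ δ in 𝓝[>] (0 : ℝ), ∀ x : Metric.sphere (0 : E) 1, q (x : E) < δ →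
      |f x - A| ≤ η := by
    intro η hη
    -- On the compact part of the sphere where `f` stays at least `η` away from `A`, the function
    -- `q` has a positive minimum. Once `δ` is below it, `{q < δ}` misses that part.
    let K : Set E := Metric.sphere (0 : E) 1 ∩ {x | η ≤ |f x - A|}
    have hK : IsCompact K :=
      (isCompact_sphere _ _).inter_right (isClosed_le continuous_const (by fun_prop))
    rcases K.eq_empty_or_nonempty with hKe | hKn
    · refine Eventually.of_forall fun δ x _ => ?_
      by_contra hcon
      exact (hKe ▸ (⟨x.2, (not_le.1 hcon).le⟩ : (x : E) ∈ K) : (x : E) ∈ (∅ : Set E))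
    · obtain ⟨y, hy, hmin⟩ := hK.exists_isMinOn hKn hq.continuousOn
      have hy1 : ‖y‖ = 1 := by simpa using hy.1
      have hqy : 0 < q y := by
        refine lt_of_le_of_ne (hq0 y) fun h => ?_
        have h2 : η ≤ |f y - A| := hy.2
        rw [hA y hy1 h.symm] at h2
        simp at h2
        linarith
      filter_upwards [Ioo_mem_nhdsGT hqy] with δ hδ x hx
      by_contra hcon
      have : q y ≤ q x := hmin (⟨x.2, (not_le.1 hcon).le⟩ : (x : E) ∈ K)
      linarith [hδ.2]
  have hdiff : Tendsto (fun δ => (∫ x in {x | q (x : E) < δ}, (f (x : E) - A) ∂σ) / δ ^ d)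
      (𝓝[>] 0) (𝓝 0) := by
    rw [Metric.tendsto_nhds]
    intro ε hε
    have hb : ∀ᶠ δ in 𝓝[>] (0 : ℝ), σ.real {x | q (x : E) < δ} / δ ^ d < |c| + 1 :=
      hm.eventually (gt_mem_nhds (by linarith [le_abs_self c]))
    have hc1 : 0 < |c| + 1 := by positivity
    filter_upwards [hb, hclose (ε / (2 * (|c| + 1))) (by positivity), self_mem_nhdsWithin]
      with δ h1 h2 (h3 : 0 < δ)
    have hδd : 0 < δ ^ d := by positivity
    rw [dist_zero_right, norm_div, Real.norm_of_nonneg hδd.le]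
    have h4 : ‖∫ x in {x | q (x : E) < δ}, (f (x : E) - A) ∂σ‖ ≤
        ε / (2 * (|c| + 1)) * σ.real {x | q (x : E) < δ} :=
      norm_setIntegral_le_of_norm_le_const (measure_lt_top _ _) fun x hx => h2 x hx
    calc _ ≤ ε / (2 * (|c| + 1)) * σ.real {x | q (x : E) < δ} / δ ^ d := by gcongr
      _ = ε / (2 * (|c| + 1)) * (σ.real {x | q (x : E) < δ} / δ ^ d) := by ring
      _ ≤ ε / (2 * (|c| + 1)) * (|c| + 1) := by gcongr
      _ = ε / 2 := by field_simp
      _ < ε := by linarith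
  have hsum := hdiff.add (hm.mul_const A)
  rw [zero_add] at hsum
  refine hsum.congr fun δ => ?_
  rw [integral_sub hInt.integrableOn (integrable_const A), setIntegral_const, smul_eq_mul]
  ring

/-- Asymptotics of Gaussian integrals over the shrinking cone-like sets `{q < ε}`. -/
lemma tendsto_setIntegral_stdGaussian_div [Nontrivial E] {q : E → ℝ} (hq : Continuous q)
    (hq0 : ∀ x, 0 ≤ q x) (hq2 : ∀ (r : ℝ) x, q (r • x) = r ^ 2 * q x) {d : ℕ} {c : ℝ} (hc : 0 < c)
    (hm : Tendsto (fun δ => (stdGaussian E).real {x | q x < δ * ‖x‖ ^ 2} / δ ^ d) (𝓝[>] 0) (𝓝 c))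
    (hdim : 2 * d < Module.finrank ℝ E) {f : E → ℝ} (hf : Continuous f) {B : ℝ}
    (hfB : ∀ x, |f x| ≤ B) {x₀ : E}
    (hfx : ∀ (r : ℝ) x, ‖x‖ = 1 → q x = 0 → f (r • x) = f (r • x₀)) :
    Tendsto (fun ε => (∫ x in {x | q x < ε}, f x ∂(stdGaussian E)) / ε ^ d) (𝓝[>] 0)
      (𝓝 (∫ r, c * f (r • x₀) * (r ^ (2 * d))⁻¹ ∂((stdGaussian E).map norm))) := by
  have hρ : IsProbabilityMeasure ((stdGaussian E).map norm) :=
    Measure.isProbabilityMeasure_map measurable_norm.aemeasurable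
  set ρ := (stdGaussian E).map norm with hρdef
  set σ := sphereProb E
  have hB : 0 ≤ B := (abs_nonneg _).trans (hfB 0)
  simp_rw [stdGaussian_real_lt_mul_norm_sq hq hq2] at hm
  obtain ⟨C, hC, hmC⟩ := exists_le_mul_pow (fun δ => measureReal_le_one) hc hm
  have hM : Measurable fun p : Metric.sphere (0 : E) 1 × ℝ => p.2 • (p.1 : E) := by fun_prop
  -- The contribution of the sphere of radius `r` to the integral over `{q < ε}`.
  let J : ℝ → ℝ → ℝ := fun ε r => ∫ x : Metric.sphere (0 : E) 1,
    {x : E | q x < ε}.indicator f (r • (x : E)) ∂σ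
  have hsE : ∀ ε, MeasurableSet {x : E | q x < ε} := fun ε =>
    measurableSet_lt hq.measurable measurable_const
  have hind : ∀ ε, Measurable ({x : E | q x < ε}.indicator f) := fun ε =>
    hf.measurable.indicator (hsE ε)
  have hJmeas : ∀ ε, AEStronglyMeasurable (J ε) ρ := by
    intro ε
    have : StronglyMeasurable (Function.uncurry fun (r : ℝ) (x : Metric.sphere (0 : E) 1) =>
        {x : E | q x < ε}.indicator f (r • (x : E))) :=
      ((hind ε).comp (by fun_prop : Measurable fun p : ℝ × Metric.sphere (0 : E) 1 =>
        p.1 • (p.2 : E))).stronglyMeasurable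
    exact this.integral_prod_right.aestronglyMeasurable
  have hA : ∀ ε, ∫ x in {x | q x < ε}, f x ∂(stdGaussian E) = ∫ r, J ε r ∂ρ := by
    intro ε
    rw [← integral_indicator (hsE ε)]
    conv_lhs => rw [stdGaussian_eq_map_prod]
    rw [integral_map hM.aemeasurable (hind ε).aestronglyMeasurable, integral_prod_symm]
    refine Integrable.of_bound ((hind ε).comp hM).aestronglyMeasurable B
      (Eventually.of_forall fun p => ?_)
    refine (norm_indicator_le_norm_self _ _).trans (hfB _)
  have hJ : ∀ ε r, 0 < r → J ε r =
      ∫ x in {x : Metric.sphere (0 : E) 1 | q (x : E) < ε / r ^ 2}, f (r • (x : E)) ∂σ := by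
    intro ε r hr
    have hs' : MeasurableSet {x : Metric.sphere (0 : E) 1 | q (x : E) < ε / r ^ 2} :=
      measurableSet_lt (hq.measurable.comp measurable_subtype_coe) measurable_const
    rw [← integral_indicator hs']
    refine integral_congr_ae (Eventually.of_forall fun x => ?_)
    have hiff : q (r • (x : E)) < ε ↔ q (x : E) < ε / r ^ 2 := by
      rw [hq2, lt_div_iff₀ (by positivity), mul_comm]
    by_cases hx : q (x : E) < ε / r ^ 2
    · simp only [Set.indicator, Set.mem_ofPred_eq, hiff, hx]
    · simp only [Set.indicator, Set.mem_ofPred_eq, hiff, hx]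
  simp_rw [hA, ← integral_div]
  have hpos := ae_norm_pos E
  rw [← hρdef] at hpos
  -- At radius `r` the spherical mass is at most `C * (ε / r ^ 2) ^ d`; division by `ε ^ d` leaves a
  -- bound without `ε`, integrable because `2 * d` is less than the dimension.
  refine tendsto_integral_filter_of_dominated_convergence (fun r => B * C * (r ^ (2 * d))⁻¹)
    (Eventually.of_forall fun ε => (by simpa only [div_eq_mul_inv] using (hJmeas ε).mul_const (ε ^ d)⁻¹)) ?_ ?_ ?_
  · filter_upwards [self_mem_nhdsWithin] with ε (hε : 0 < ε)
    filter_upwards [hpos] with r hr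
    rw [hJ ε r hr, norm_div, Real.norm_of_nonneg (by positivity : 0 ≤ ε ^ d),
      div_le_iff₀ (by positivity)]
    calc _ ≤ B * σ.real {x : Metric.sphere (0 : E) 1 | q (x : E) < ε / r ^ 2} :=
          norm_setIntegral_le_of_norm_le_const (measure_lt_top _ _) fun x _ => hfB _
      _ ≤ B * (C * (ε / r ^ 2) ^ d) := by
          gcongr
          exact hmC _ (by positivity)
      _ = _ := by rw [div_pow, ← pow_mul]; ring
  · exact (integrable_norm_pow_inv hdim).const_mul _
  · filter_upwards [hpos] with r hr
    have h1 := tendsto_setIntegral_sphere_div (σ := σ) hq hq0 (f := fun x => f (r • x))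
      (by fun_prop) (hfx r) hm
    have h2 : Tendsto (fun ε : ℝ => ε / r ^ 2) (𝓝[>] 0) (𝓝[>] 0) := by
      refine tendsto_nhdsWithin_iff.2 ⟨?_, ?_⟩
      · have : Tendsto (fun ε : ℝ => ε / r ^ 2) (𝓝 0) (𝓝 (0 / r ^ 2)) :=
          tendsto_id.div_const _
        rw [zero_div] at this
        exact this.mono_left nhdsWithin_le_nhds
      · filter_upwards [self_mem_nhdsWithin] with ε (hε : 0 < ε)
        exact div_pos hε (by positivity)
    refine ((h1.comp h2).mul_const (r ^ (2 * d))⁻¹).congr fun ε => ?_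
    simp only [Function.comp_apply]
    rw [hJ ε r hr, div_pow, ← pow_mul]
    have hrd : r ^ (2 * d) ≠ 0 := by positivity
    generalize (∫ x in _, f (r • (x : E)) ∂σ) = I
    field_simp

/-- A conditional expectation is a quotient of two integrals over `{q < ε}`, both of order `ε ^ d`.
In the numerator `h` may be replaced by its average over the group, which depends on the radius only
along `{q = 0}`, since that set meets the unit sphere within one orbit. The constant `c` cancels in
the quotient. -/
theorem exists_tendsto_integral_cond [Nontrivial E] {G : Type*} [Group G] [TopologicalSpace G]
    [CompactSpace G] [MeasurableSpace G] [BorelSpace G] [ContinuousMul G] {η : Measure G}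
    [IsProbabilityMeasure η] [η.IsMulRightInvariant] {act : G → E → E}
    (hact : Continuous fun p : G × E => act p.1 p.2)
    (hmp : ∀ g, (stdGaussian E).map (act g) = stdGaussian E)
    (hmul : ∀ g h x, act (g * h) x = act g (act h x))
    (hsmul : ∀ g (r : ℝ) x, act g (r • x) = r • act g x)
    {q : E → ℝ} (hq : Continuous q)
    (hq0 : ∀ x, 0 ≤ q x) (hq2 : ∀ (r : ℝ) x, q (r • x) = r ^ 2 * q x)
    (hqact : ∀ g x, q (act g x) = q x) {x₀ : E}
    (horb : ∀ x, ‖x‖ = 1 → q x = 0 → ∃ g, act g x₀ = x) {d : ℕ} {c : ℝ} (hc : 0 < c)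
    (hm : Tendsto (fun δ => (stdGaussian E).real {x | q x < δ * ‖x‖ ^ 2} / δ ^ d) (𝓝[>] 0) (𝓝 c))
    (hdim : 2 * d < Module.finrank ℝ E) :
    ∃ ρ : Measure ℝ, IsProbabilityMeasure ρ ∧ (∀ᵐ r ∂ρ, 0 < r) ∧ ∀ h : E →ᵇ ℝ,
      Tendsto (fun ε => ∫ x, h x ∂(cond (stdGaussian E) {x | q x < ε})) (𝓝[>] 0)
        (𝓝 (∫ r, ∫ g, h (r • act g x₀) ∂η ∂ρ)) := by
  have hρ : IsProbabilityMeasure ((stdGaussian E).map norm) :=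
    Measure.isProbabilityMeasure_map measurable_norm.aemeasurable
  have hpos := ae_norm_pos E
  set ρ₀ := (stdGaussian E).map norm with hρdef
  have hInt : Integrable (fun r : ℝ => (r ^ (2 * d))⁻¹) ρ₀ :=
    integrable_norm_pow_inv hdim
  have hnonneg : 0 ≤ᵐ[ρ₀] fun r : ℝ => (r ^ (2 * d))⁻¹ := by
    filter_upwards [hpos] with r hr
    change (0 : ℝ) ≤ (r ^ (2 * d))⁻¹
    positivity
  set Z : ℝ := ∫ r, (r ^ (2 * d))⁻¹ ∂ρ₀ with hZdef
  have hZ : 0 < Z := by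
    rw [hZdef, integral_pos_iff_support_of_nonneg_ae hnonneg hInt]
    have hsup : ∀ᵐ r ∂ρ₀, r ∈ Function.support fun r : ℝ => (r ^ (2 * d))⁻¹ := by
      filter_upwards [hpos] with r hr
      have : (0 : ℝ) < (r ^ (2 * d))⁻¹ := by positivity
      exact this.ne'
    rw [measure_eq_measure_of_null_sdiff (Set.subset_univ _)
      (by rw [← Set.compl_eq_univ_sdiff]; exact hsup)]
    simp
  -- Since `q < ε` means `q < ε / r ^ 2` for the direction, conditioning favours small radii; in the
  -- limit the law of the norm is weighted by `r ^ (-2d)`, and `Z` normalizes it.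
  let D : ℝ → ℝ≥0∞ := fun r => ENNReal.ofReal (Z⁻¹ * (r ^ (2 * d))⁻¹)
  have hD : Measurable D := by fun_prop
  refine ⟨ρ₀.withDensity D, ⟨?_⟩, (withDensity_absolutelyContinuous _ _).ae_le hpos, fun h => ?_⟩
  · rw [withDensity_apply _ MeasurableSet.univ, Measure.restrict_univ,
      ← ofReal_integral_eq_lintegral_ofReal (hInt.const_mul _)
        (by filter_upwards [hnonneg] with r hr
            exact mul_nonneg (inv_nonneg.2 hZ.le) hr),
      integral_const_mul, ← hZdef, inv_mul_cancel₀ hZ.ne']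
    simp
  have hsE : ∀ ε, MeasurableSet {x : E | q x < ε} := fun ε =>
    measurableSet_lt hq.measurable measurable_const
  have hfx : ∀ (r : ℝ) x, ‖x‖ = 1 → q x = 0 →
      ∫ g, h (act g (r • x)) ∂η = ∫ g, h (act g (r • x₀)) ∂η := by
    intro r x hx hqx
    obtain ⟨g₀, rfl⟩ := horb x hx hqx
    -- With `x = act g₀ x₀`, right translation by `g₀` absorbs the choice of the point in the orbit.
    have := integral_mul_right_eq_self (μ := η) (fun g => h (act g (r • x₀))) g₀
    rw [← this]
    refine integral_congr_ae (Eventually.of_forall fun g => ?_)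
    simp only [hsmul, hmul]
  have hlim := tendsto_setIntegral_stdGaussian_div hq hq0 hq2 hc hm hdim
    (continuous_average (η := η) hact h) (fun x => abs_average_le h x) hfx
  -- The constant function 1 gives the denominator, the mass of the conditioning event.
  have hlim1 := tendsto_setIntegral_stdGaussian_div hq hq0 hq2 hc hm hdim
    (f := fun _ => (1 : ℝ)) continuous_const (B := 1) (by simp) (x₀ := x₀) (by simp)
  have hone : ∫ r, c * 1 * (r ^ (2 * d))⁻¹ ∂ρ₀ = c * Z := by
    rw [mul_one, integral_const_mul]
  rw [hone] at hlim1
  have hratio := hlim.div hlim1 (by positivity)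
  have hval : (∫ r, c * (∫ g, h (act g (r • x₀)) ∂η) * (r ^ (2 * d))⁻¹ ∂ρ₀) / (c * Z) =
      ∫ r, ∫ g, h (r • act g x₀) ∂η ∂(ρ₀.withDensity D) := by
    rw [integral_withDensity_eq_integral_toReal_smul hD (by simp [D]), ← integral_div]
    refine integral_congr_ae ?_
    filter_upwards [hnonneg] with r hr
    have hr : (0 : ℝ) ≤ (r ^ (2 * d))⁻¹ := hr
    simp only [D]
    rw [ENNReal.toReal_ofReal (mul_nonneg (inv_nonneg.2 hZ.le) hr), smul_eq_mul]
    simp only [hsmul]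
    field_simp
  rw [hval] at hratio
  refine hratio.congr' ?_
  filter_upwards [self_mem_nhdsWithin] with ε (hε : 0 < ε)
  simp only [Pi.div_apply]
  rw [div_div_div_cancel_right₀ (by positivity),
    setIntegral_average hact hmp (hsE ε) (fun g x => by simp [hqact]) h]
  rw [ProbabilityTheory.cond, integral_smul_measure, setIntegral_const, smul_eq_mul, smul_eq_mul, mul_one,
    ENNReal.toReal_inv, Measure.real, div_eq_inv_mul]

end Limit

/-! ### Moments and the beta distribution -/

lemma integrable_of_continuousOn_of_ae_mem {P : Measure ℝ} [IsFiniteMeasure P]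
    (hP : ∀ᵐ x ∂P, x ∈ Set.Icc (0 : ℝ) 1) {f : ℝ → ℝ} (hf : Continuous f) : Integrable f P := by
  obtain ⟨B, hB⟩ := (isCompact_Icc.image_of_continuousOn hf.continuousOn :
    IsCompact (f '' Set.Icc (0 : ℝ) 1)).isBounded.exists_norm_le
  refine Integrable.of_bound hf.aestronglyMeasurable B ?_
  filter_upwards [hP] with x hx using hB _ ⟨x, hx, rfl⟩

/-- Probability measures on the unit interval are determined by their moments. -/
theorem measure_ext_of_moments {P Q : Measure ℝ} [IsProbabilityMeasure P] [IsProbabilityMeasure Q]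
    (hP : ∀ᵐ x ∂P, x ∈ Set.Icc (0 : ℝ) 1) (hQ : ∀ᵐ x ∂Q, x ∈ Set.Icc (0 : ℝ) 1)
    (h : ∀ k : ℕ, ∫ x, x ^ k ∂P = ∫ x, x ^ k ∂Q) : P = Q := by
  have hpoly : ∀ p : Polynomial ℝ, ∫ x, p.eval x ∂P = ∫ x, p.eval x ∂Q := by
    intro p
    simp_rw [Polynomial.eval_eq_sum_range]
    rw [integral_finsetSum, integral_finsetSum]
    · simp_rw [integral_const_mul, h]
    · exact fun i _ => integrable_of_continuousOn_of_ae_mem hQ (by fun_prop)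
    · exact fun i _ => integrable_of_continuousOn_of_ae_mem hP (by fun_prop)
  refine ext_of_forall_integral_eq_of_IsFiniteMeasure fun f => ?_
  refine eq_of_forall_dist_le fun ε hε => ?_
  -- Weierstrass approximation on the unit interval suffices, because both measures are concentrated
  -- there.
  obtain ⟨p, hp⟩ := exists_polynomial_near_of_continuousOn 0 1 f f.continuous.continuousOn (ε / 2)
    (by positivity)
  have key : ∀ ν : Measure ℝ, IsProbabilityMeasure ν → (∀ᵐ x ∂ν, x ∈ Set.Icc (0 : ℝ) 1) →
      |∫ x, f x ∂ν - ∫ x, p.eval x ∂ν| ≤ ε / 2 := by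
    intro ν _ hν
    rw [← integral_sub (integrable_of_continuousOn_of_ae_mem hν f.continuous)
      (integrable_of_continuousOn_of_ae_mem hν p.continuous)]
    have := norm_integral_le_of_norm_le_const (μ := ν) (f := fun x => f x - p.eval x) (C := ε / 2)
      (by filter_upwards [hν] with x hx
          rw [Real.norm_eq_abs, abs_sub_comm]
          exact (hp x hx).le)
    simpa using this
  have h1 := abs_le.1 (key P inferInstance hP)
  have h2 := abs_le.1 (key Q inferInstance hQ)
  rw [hpoly p] at h1
  rw [Real.dist_eq, abs_le]
  constructor <;> linarith [h1.1, h1.2, h2.1, h2.2]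

lemma betaPDFReal_nonneg' {a b : ℝ} (ha : 0 < a) (hb : 0 < b) (x : ℝ) : 0 ≤ betaPDFReal a b x := by
  by_cases hx : 0 < x ∧ x < 1
  · exact (betaPDFReal_pos hx.1 hx.2 ha hb).le
  · simp [betaPDFReal, hx]

lemma integrable_betaPDFReal {a b : ℝ} (ha : 0 < a) (hb : 0 < b) :
    Integrable (betaPDFReal a b) := by
  refine ⟨(measurable_betaPDFReal a b).aestronglyMeasurable, ?_⟩
  rw [hasFiniteIntegral_iff_ofReal (Eventually.of_forall (betaPDFReal_nonneg' ha hb))]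
  exact (lintegral_betaPDF_eq_one ha hb).trans_lt ENNReal.one_lt_top

lemma integral_betaPDFReal {a b : ℝ} (ha : 0 < a) (hb : 0 < b) :
    ∫ x, betaPDFReal a b x = 1 := by
  rw [integral_eq_lintegral_of_nonneg_ae (Eventually.of_forall (betaPDFReal_nonneg' ha hb))
    (measurable_betaPDFReal a b).aestronglyMeasurable]
  exact (congrArg ENNReal.toReal (lintegral_betaPDF_eq_one ha hb)).trans ENNReal.toReal_one

/-- Multiplying the density by `x ^ k` only shifts the first parameter to `a + k` and changes the
normalization. -/
lemma integral_pow_betaMeasure {a b : ℝ} (ha : 0 < a) (hb : 0 < b) (k : ℕ) :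
    ∫ x, x ^ k ∂(betaMeasure a b) = beta (a + k) b / beta a b := by
  rw [betaMeasure, integral_withDensity_eq_integral_toReal_smul
    (f := betaPDF a b) (measurable_betaPDFReal a b).ennreal_ofReal (by simp [betaPDF])]
  have hB := beta_pos (by positivity : 0 < a + k) hb
  have h1 : ∀ x : ℝ, (betaPDF a b x).toReal • x ^ k =
      beta (a + k) b / beta a b * betaPDFReal (a + k) b x := by
    intro x
    rw [betaPDF, ENNReal.toReal_ofReal (betaPDFReal_nonneg' ha hb x), smul_eq_mul]
    by_cases hx : 0 < x ∧ x < 1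
    · simp only [betaPDFReal, hx, and_self, if_true]
      rw [show a + k - 1 = (a - 1) + k by ring, Real.rpow_add hx.1, Real.rpow_natCast]
      field_simp
    · simp [betaPDFReal, hx]
  simp_rw [h1]
  rw [integral_const_mul, integral_betaPDFReal (by positivity) hb, mul_one]

lemma ae_mem_Icc_betaMeasure (a b : ℝ) : ∀ᵐ x ∂(betaMeasure a b), x ∈ Set.Icc (0 : ℝ) 1 := by
  have hm : Measurable (betaPDF a b) := (measurable_betaPDFReal a b).ennreal_ofReal
  rw [betaMeasure, ae_withDensity_iff hm]
  refine Eventually.of_forall fun x hx => ⟨?_, ?_⟩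
  · by_contra h
    exact hx (betaPDF_eq_zero_of_nonpos (not_le.1 h).le)
  · by_contra h
    exact hx (betaPDF_eq_zero_of_one_le (not_le.1 h).le)

lemma integral_Ioo_one_sub_rpow {b t : ℝ} (hb : 0 < b) (ht : 0 < t) :
    IntegrableOn (fun x : ℝ => (1 - x) ^ (b - 1)) (Set.Ioo (1 - t) 1) ∧
    ∫ x in Set.Ioo (1 - t) 1, (1 - x) ^ (b - 1) = t ^ b / b := by
  have h0 : IntervalIntegrable (fun x : ℝ => x ^ (b - 1)) volume 0 t :=
    intervalIntegral.intervalIntegrable_rpow' (by linarith)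
  constructor
  · have h1 := (h0.comp_sub_left 1).symm
    simp only [sub_zero] at h1
    rw [intervalIntegrable_iff_integrableOn_Ioo_of_le (by linarith)] at h1
    exact h1
  · rw [← integral_Ioc_eq_integral_Ioo, ← intervalIntegral.integral_of_le (by linarith),
      intervalIntegral.integral_comp_sub_left (fun x : ℝ => x ^ (b - 1)) 1]
    simp only [sub_self, sub_sub_cancel]
    rw [integral_rpow (Or.inl (by linarith))]
    simp [hb.ne']

/-- The mass of the beta distribution near `1`. -/
theorem tendsto_betaMeasure_Ioi_div {a b : ℝ} (ha : 0 < a) (hb : 0 < b) :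
    Tendsto (fun t => (betaMeasure a b).real (Set.Ioi (1 - t)) / t ^ b) (𝓝[>] 0)
      (𝓝 (1 / (beta a b * b))) := by
  have hB := beta_pos ha hb
  have hval : ∀ t : ℝ, 0 < t → t < 1 → (betaMeasure a b).real (Set.Ioi (1 - t)) =
      ∫ x in Set.Ioo (1 - t) 1, 1 / beta a b * x ^ (a - 1) * (1 - x) ^ (b - 1) := by
    intro t ht ht1
    rw [Measure.real, betaMeasure, withDensity_apply _ measurableSet_Ioi]
    have h1 : ∫⁻ x in Set.Ioi (1 - t), betaPDF a b x =
        ENNReal.ofReal (∫ x in Set.Ioi (1 - t), betaPDFReal a b x) := by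
      rw [ofReal_integral_eq_lintegral_ofReal (integrable_betaPDFReal ha hb).integrableOn
        (Eventually.of_forall (betaPDFReal_nonneg' ha hb))]
      rfl
    rw [h1, ENNReal.toReal_ofReal (integral_nonneg (betaPDFReal_nonneg' ha hb))]
    rw [← integral_indicator measurableSet_Ioi, ← integral_indicator measurableSet_Ioo]
    congr 1
    funext x
    by_cases hx : x ∈ Set.Ioo (1 - t) 1
    · have hx0 : 0 < x := by linarith [hx.1]
      rw [Set.indicator_of_mem hx, Set.indicator_of_mem (show x ∈ Set.Ioi (1 - t) from hx.1),
        betaPDFReal, if_pos ⟨hx0, hx.2⟩]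
    · rw [Set.indicator_of_notMem hx]
      by_cases hx2 : x ∈ Set.Ioi (1 - t)
      · rw [Set.indicator_of_mem hx2, betaPDFReal, if_neg]
        exact fun h => hx ⟨hx2, h.2⟩
      · rw [Set.indicator_of_notMem hx2]
  have hpow : Tendsto (fun t : ℝ => (1 - t) ^ (a - 1)) (𝓝[>] 0) (𝓝 1) := by
    have : ContinuousAt (fun t : ℝ => (1 - t) ^ (a - 1)) 0 :=
      ContinuousAt.rpow_const (by fun_prop) (Or.inl (by norm_num))
    have h2 := this.tendsto
    simp only [sub_zero, Real.one_rpow] at h2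
    exact h2.mono_left nhdsWithin_le_nhds
  have hlow : Tendsto (fun t : ℝ => min 1 ((1 - t) ^ (a - 1)) * (1 / (beta a b * b))) (𝓝[>] 0)
      (𝓝 (1 / (beta a b * b))) := by
    simpa using ((tendsto_const_nhds (x := (1 : ℝ))).min hpow).mul_const (1 / (beta a b * b))
  have hupp : Tendsto (fun t : ℝ => max 1 ((1 - t) ^ (a - 1)) * (1 / (beta a b * b))) (𝓝[>] 0)
      (𝓝 (1 / (beta a b * b))) := by
    simpa using ((tendsto_const_nhds (x := (1 : ℝ))).max hpow).mul_const (1 / (beta a b * b))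
  -- The factor `x ^ (a - 1)` is monotone, so it lies between its endpoint values; the minimum and
  -- maximum cover both signs of `a - 1`. Both bounds tend to 1, and what remains is the explicit
  -- integral of `(1 - x) ^ (b - 1)`.
  have hbd : ∀ t : ℝ, 0 < t → t < 1 → ∀ x ∈ Set.Ioo (1 - t) 1,
      min 1 ((1 - t) ^ (a - 1)) ≤ x ^ (a - 1) ∧ x ^ (a - 1) ≤ max 1 ((1 - t) ^ (a - 1)) := by
    intro t ht ht1 x hx
    have h1t : 0 < 1 - t := by linarith
    have hx0 : 0 < x := h1t.trans hx.1
    rcases le_total 0 (a - 1) with h | h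
    · exact ⟨(min_le_right _ _).trans (Real.rpow_le_rpow h1t.le hx.1.le h),
        (Real.rpow_le_one hx0.le hx.2.le h).trans (le_max_left _ _)⟩
    · exact ⟨(min_le_left _ _).trans (Real.one_le_rpow_of_pos_of_le_one_of_nonpos hx0 hx.2.le h),
        (Real.rpow_le_rpow_of_nonpos h1t hx.1.le h).trans (le_max_right _ _)⟩
  have hI : ∀ t : ℝ, 0 < t → t < 1 → IntegrableOn
      (fun x : ℝ => 1 / beta a b * x ^ (a - 1) * (1 - x) ^ (b - 1)) (Set.Ioo (1 - t) 1) := by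
    intro t ht ht1
    refine ((integrable_betaPDFReal ha hb).integrableOn (s := Set.Ioo (1 - t) 1)).congr_fun
      (fun x hx => ?_) measurableSet_Ioo
    have hx0 : 0 < x := by linarith [hx.1]
    simp only [betaPDFReal, hx0, hx.2, and_self, if_true]
  refine tendsto_of_tendsto_of_tendsto_of_le_of_le' hlow hupp ?_ ?_
  · filter_upwards [Ioo_mem_nhdsGT (zero_lt_one' ℝ)] with t ⟨ht, ht1⟩
    obtain ⟨hi, hv⟩ := integral_Ioo_one_sub_rpow hb ht
    have htb : 0 < t ^ b := Real.rpow_pos_of_pos ht b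
    rw [hval t ht ht1, le_div_iff₀ htb]
    calc min 1 ((1 - t) ^ (a - 1)) * (1 / (beta a b * b)) * t ^ b
        = ∫ x in Set.Ioo (1 - t) 1, (1 / beta a b * min 1 ((1 - t) ^ (a - 1))) *
            (1 - x) ^ (b - 1) := by
          rw [integral_const_mul, hv]
          field_simp
      _ ≤ _ := by
          refine setIntegral_mono_on (hi.const_mul _) (hI t ht ht1) measurableSet_Ioo
            fun x hx => ?_
          have hx1 : 0 ≤ (1 - x) ^ (b - 1) := Real.rpow_nonneg (by linarith [hx.2]) _
          gcongr
          exact (hbd t ht ht1 x hx).1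
  · filter_upwards [Ioo_mem_nhdsGT (zero_lt_one' ℝ)] with t ⟨ht, ht1⟩
    obtain ⟨hi, hv⟩ := integral_Ioo_one_sub_rpow hb ht
    have htb : 0 < t ^ b := Real.rpow_pos_of_pos ht b
    rw [hval t ht ht1, div_le_iff₀ htb]
    calc ∫ x in Set.Ioo (1 - t) 1, 1 / beta a b * x ^ (a - 1) * (1 - x) ^ (b - 1)
        ≤ ∫ x in Set.Ioo (1 - t) 1, (1 / beta a b * max 1 ((1 - t) ^ (a - 1))) *
            (1 - x) ^ (b - 1) := by
          refine setIntegral_mono_on (hI t ht ht1) (hi.const_mul _) measurableSet_Ioo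
            fun x hx => ?_
          have hx1 : 0 ≤ (1 - x) ^ (b - 1) := Real.rpow_nonneg (by linarith [hx.2]) _
          gcongr
          exact (hbd t ht ht1 x hx).2
      _ = _ := by
          rw [integral_const_mul, hv]
          field_simp

/-- The Gamma-function identity behind the distribution of the normalized Gram determinant. -/
lemma gamma_duplication_ratio {M p b : ℝ} (hM : 0 < M) (hp : 0 < p) (hb0 : 0 < b)
    (hb : p / 2 + b = (M + 1) / 2) (k : ℕ) :
    4 ^ k * (2 ^ k * Real.Gamma (M / 2 + k) / Real.Gamma (M / 2)) *
      (2 ^ k * Real.Gamma (p / 2 + k) / Real.Gamma (p / 2)) =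
    beta (p / 2 + k) b / beta (p / 2) b *
      (2 ^ (2 * k) * Real.Gamma (M + (2 * k : ℕ)) / Real.Gamma M) := by
  -- Legendre duplication at `M / 2` and at `M / 2 + k`. The relation between `p`, `b` and `M` makes
  -- the half-shifted Gamma values exactly those in the two beta functions.
  have d0 := Real.Gamma_mul_Gamma_add_half (M / 2)
  have d1 := Real.Gamma_mul_Gamma_add_half (M / 2 + k)
  rw [show 2 * (M / 2) = M by ring] at d0
  rw [show 2 * (M / 2 + k) = M + (2 * k : ℕ) by push_cast; ring] at d1
  have e : (2 : ℝ) ^ (1 - M) = 4 ^ k * 2 ^ (1 - (M + (2 * k : ℕ))) := by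
    rw [show (1 : ℝ) - M = (2 * k : ℕ) + (1 - (M + (2 * k : ℕ))) by ring, Real.rpow_add two_pos,
      Real.rpow_natCast, pow_mul]
    norm_num
  rw [e] at d0
  have g1 := Real.Gamma_pos_of_pos (by positivity : 0 < M / 2)
  have g2 := Real.Gamma_pos_of_pos (by positivity : 0 < p / 2)
  have g3 := Real.Gamma_pos_of_pos hM
  have g4 := Real.Gamma_pos_of_pos (by positivity : 0 < M / 2 + 1 / 2)
  have g5 := Real.Gamma_pos_of_pos (by positivity : 0 < M / 2 + k + 1 / 2)
  have g6 := Real.Gamma_pos_of_pos hb0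
  have hX : 0 < (2 : ℝ) ^ (1 - (M + (2 * k : ℕ))) * √Real.pi := by positivity
  unfold ProbabilityTheory.beta
  rw [show p / 2 + k + b = M / 2 + k + 1 / 2 by linarith, show p / 2 + b = M / 2 + 1 / 2 by linarith]
  have key : 4 ^ k * Real.Gamma (M / 2 + k) * Real.Gamma M * Real.Gamma (M / 2 + k + 1 / 2) =
      Real.Gamma (M / 2) * Real.Gamma (M / 2 + 1 / 2) * Real.Gamma (M + (2 * k : ℕ)) := by
    rw [d0]
    linear_combination 4 ^ k * Real.Gamma M * d1
  rw [pow_mul, show (2 : ℝ) ^ 2 = 4 by norm_num]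
  have h22 : (2 : ℝ) ^ k * 2 ^ k = 4 ^ k := by rw [← mul_pow]; norm_num
  generalize Real.Gamma (M / 2 + k) = A1 at *
  generalize Real.Gamma (M / 2 + k + 1 / 2) = A2 at *
  generalize Real.Gamma (M / 2 + 1 / 2) = A3 at *
  generalize Real.Gamma (M / 2) = A4 at *
  generalize Real.Gamma (p / 2 + k) = A5 at *
  generalize Real.Gamma (p / 2) = A6 at *
  generalize Real.Gamma (M + (2 * k : ℕ)) = A7 at *
  generalize Real.Gamma M = A8 at *
  generalize Real.Gamma b = A9 at *
  generalize (2 : ℝ) ^ k = T at *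
  generalize (4 : ℝ) ^ k = U at *
  have hk : U * (T * A1 / A4) * (T * A5 / A6) = U * (U * (A1 * A5 / (A4 * A6))) := by
    rw [← h22]; ring
  rw [hk]
  field_simp
  linear_combination U * A5 * key

/-! ### Projections and pairs of Gaussian vectors; the law of a Gram determinant -/

section Gram

variable {V : Type*} [NormedAddCommGroup V] [InnerProductSpace ℝ V] [FiniteDimensional ℝ V]
  [MeasurableSpace V] [BorelSpace V]

/-- For `t` in `T`, pairing with the projection of `x` is pairing with `x`, so the characteristic
functions agree. -/
lemma stdGaussian_map_orthogonalProjection (T : Submodule ℝ V) :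
    (stdGaussian V).map T.orthogonalProjectionOnto = stdGaussian T := by
  have hm : Measurable T.orthogonalProjectionOnto := T.orthogonalProjectionOnto.continuous.measurable
  have : IsProbabilityMeasure ((stdGaussian V).map T.orthogonalProjectionOnto) :=
    Measure.isProbabilityMeasure_map hm.aemeasurable
  apply Measure.ext_of_charFun
  ext t
  rw [charFun_stdGaussian, charFun_apply, integral_map hm.aemeasurable (by fun_prop)]
  have h := charFun_stdGaussian (E := V) (t : V)
  rw [charFun_apply] at h
  have hin : ∀ x : V, inner ℝ (T.orthogonalProjectionOnto x) t = inner ℝ x (t : V) := fun x =>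
    Submodule.inner_orthogonalProjectionOnto_eq_of_mem_right t x
  simp_rw [hin, h]
  simp

lemma stdGaussian_withLp_prod {W : Type*} [NormedAddCommGroup W] [InnerProductSpace ℝ W]
    [FiniteDimensional ℝ W] [MeasurableSpace W] [BorelSpace W] :
    ((stdGaussian V).prod (stdGaussian W)).map (WithLp.toLp 2) =
      stdGaussian (WithLp 2 (V × W)) := by
  have hm : Measurable (WithLp.toLp 2 : V × W → WithLp 2 (V × W)) := by fun_prop
  have : IsProbabilityMeasure (((stdGaussian V).prod (stdGaussian W)).map (WithLp.toLp 2)) :=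
    Measure.isProbabilityMeasure_map hm.aemeasurable
  apply Measure.ext_of_charFun
  ext t
  rw [charFun_prod, charFun_stdGaussian, charFun_stdGaussian, charFun_stdGaussian,
    ← Complex.exp_add]
  congr 1
  have h : ‖t‖ ^ 2 = ‖t.ofLp.1‖ ^ 2 + ‖t.ofLp.2‖ ^ 2 := WithLp.prod_norm_sq_eq_of_L2 t
  rw [← Complex.ofReal_pow, ← Complex.ofReal_pow, ← Complex.ofReal_pow, h]
  push_cast
  ring

variable (V) in
lemma integral_norm_pow_stdGaussian [Nontrivial V] (k : ℕ) :
    Integrable (fun x : V => ‖x‖ ^ (2 * k)) (stdGaussian V) ∧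
    ∫ x : V, ‖x‖ ^ (2 * k) ∂(stdGaussian V) = 2 ^ k *
      Real.Gamma (Module.finrank ℝ V / 2 + k) / Real.Gamma (Module.finrank ℝ V / 2) := by
  have h := integrable_and_integral_norm_rpow V (s := ((2 * k : ℕ) : ℝ))
    (by have : 0 < Module.finrank ℝ V := Module.finrank_pos
        have : (0 : ℝ) < Module.finrank ℝ V := by exact_mod_cast this
        have h2 : (0 : ℝ) ≤ ((2 * k : ℕ) : ℝ) := Nat.cast_nonneg _
        linarith)
  simp only [Real.rpow_natCast] at h
  refine ⟨h.1, h.2.trans ?_⟩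
  have e1 : (((2 * k : ℕ) : ℝ)) / 2 = k := by push_cast; ring
  have e2 : ((Module.finrank ℝ V : ℝ) + ((2 * k : ℕ) : ℝ)) / 2 = Module.finrank ℝ V / 2 + k := by
    push_cast; ring
  rw [e1, e2, Real.rpow_natCast]

lemma integral_norm_pow_orthogonalProjection (T : Submodule ℝ V) [Nontrivial T] (k : ℕ) :
    ∫ v, ‖T.orthogonalProjectionOnto v‖ ^ (2 * k) ∂(stdGaussian V) = 2 ^ k *
      Real.Gamma (Module.finrank ℝ T / 2 + k) / Real.Gamma (Module.finrank ℝ T / 2) := by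
  rw [← (integral_norm_pow_stdGaussian T k).2, ← stdGaussian_map_orthogonalProjection,
    integral_map T.orthogonalProjectionOnto.continuous.measurable.aemeasurable (by fun_prop)]

/-- For homogeneous functions of degree four, moments factor through the norm. -/
lemma integral_pow_eq_mul_of_homogeneous [Nontrivial V] {D : V → ℝ} (hD : Continuous D)
    (hD4 : ∀ (r : ℝ) x, D (r • x) = r ^ 4 * D x) (k : ℕ) :
    ∫ x, D x ^ k ∂(stdGaussian V) =
      (∫ x, (D x / ‖x‖ ^ 4) ^ k ∂(stdGaussian V)) * ∫ x : V, ‖x‖ ^ (2 * (2 * k)) ∂(stdGaussian V) := by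
  have hρ : IsProbabilityMeasure ((stdGaussian V).map norm) :=
    Measure.isProbabilityMeasure_map measurable_norm.aemeasurable
  have hM : Measurable fun p : Metric.sphere (0 : V) 1 × ℝ => p.2 • (p.1 : V) := by fun_prop
  have hDm := hD.measurable
  have h1 : ∫ x, D x ^ k ∂(stdGaussian V) =
      (∫ x : Metric.sphere (0 : V) 1, D x ^ k ∂(sphereProb V)) *
        ∫ r, r ^ (4 * k) ∂((stdGaussian V).map norm) := by
    conv_lhs => rw [stdGaussian_eq_map_prod]
    rw [integral_map hM.aemeasurable (by fun_prop), ← integral_prod_mul]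
    refine integral_congr_ae (Eventually.of_forall fun p => ?_)
    simp only [hD4]
    ring
  have h2 : ∫ x, (D x / ‖x‖ ^ 4) ^ k ∂(stdGaussian V) =
      ∫ x : Metric.sphere (0 : V) 1, D x ^ k ∂(sphereProb V) := by
    conv_lhs => rw [stdGaussian_eq_map_prod]
    have hmk : Measurable fun x => (D x / ‖x‖ ^ 4) ^ k :=
      (hDm.div (measurable_norm.pow_const 4)).pow_const k
    rw [integral_map hM.aemeasurable hmk.aestronglyMeasurable]
    have h3 : ∫ p : Metric.sphere (0 : V) 1 × ℝ, (D p.1 ^ k) * 1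
        ∂((sphereProb V).prod ((stdGaussian V).map norm)) =
        ∫ x : Metric.sphere (0 : V) 1, D x ^ k ∂(sphereProb V) := by
      rw [integral_prod_mul (fun x : Metric.sphere (0 : V) 1 => D x ^ k) fun _ => (1 : ℝ)]
      simp
    rw [← h3]
    refine integral_congr_ae ?_
    filter_upwards [Measure.quasiMeasurePreserving_snd.ae (ae_norm_pos V)] with p hp
    rw [hD4, norm_smul, norm_eq_of_mem_sphere, mul_one, Real.norm_of_nonneg hp.le, mul_one]
    congr 1
    field_simp
  rw [h1, h2, integral_map measurable_norm.aemeasurable (by fun_prop),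
    show 4 * k = 2 * (2 * k) by ring]

/-- If `D u v = ‖u‖² ‖P v‖²`, with `P` a projection of rank `p` that depends on `u`, then the
normalized determinant `4 D / ‖(u, v)‖⁴` has a beta distribution. -/
theorem map_stdGaussian_eq_betaMeasure [Nontrivial V] {D : V → V → ℝ}
    (hD : Continuous fun x : V × V => D x.1 x.2) {p : ℕ} (hp : 0 < p) {b : ℝ} (hb : 0 < b)
    (hpb : (p : ℝ) / 2 + b = (Module.finrank ℝ V + 1) / 2)
    (hD4 : ∀ (r : ℝ) u v, D (r • u) (r • v) = r ^ 4 * D u v)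
    (hproj : ∀ u, u ≠ 0 → ∃ T : Submodule ℝ V, Module.finrank ℝ T = p ∧
      ∀ v, D u v = ‖u‖ ^ 2 * ‖T.orthogonalProjectionOnto v‖ ^ 2)
    (hD0 : ∀ u v, 0 ≤ D u v) (hD1 : ∀ u v, 4 * D u v ≤ (‖u‖ ^ 2 + ‖v‖ ^ 2) ^ 2) :
    (stdGaussian (WithLp 2 (V × V))).map (fun x => 4 * D x.fst x.snd / ‖x‖ ^ 4) =
      betaMeasure (p / 2) b := by
  have hEn : Nontrivial (WithLp 2 (V × V)) := (WithLp.equiv 2 (V × V)).nontrivial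
  set M := Module.finrank ℝ V with hMdef
  have hMpos : 0 < M := Module.finrank_pos
  have hE : Module.finrank ℝ (WithLp 2 (V × V)) = 2 * M := by
    rw [(WithLp.linearEquiv 2 ℝ (V × V)).finrank_eq, Module.finrank_prod, two_mul]
  have hcont : Continuous fun x : (WithLp 2 (V × V)) => 4 * D x.fst x.snd :=
    continuous_const.mul (hD.comp (WithLp.prod_continuous_ofLp 2 V V))
  have hmeas : Measurable fun x : (WithLp 2 (V × V)) => 4 * D x.fst x.snd / ‖x‖ ^ 4 :=
    hcont.measurable.div (by fun_prop)
  have hn : ∀ x : (WithLp 2 (V × V)), ‖x‖ ^ 4 = (‖x.fst‖ ^ 2 + ‖x.snd‖ ^ 2) ^ 2 := by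
    intro x
    rw [← WithLp.prod_norm_sq_eq_of_L2, ← pow_mul]
  have hbeta : IsProbabilityMeasure (betaMeasure (p / 2 : ℝ) b) :=
    isProbabilityMeasureBeta (by positivity) hb
  have hmap : IsProbabilityMeasure
      ((stdGaussian (WithLp 2 (V × V))).map (fun x => 4 * D x.fst x.snd / ‖x‖ ^ 4)) :=
    Measure.isProbabilityMeasure_map hmeas.aemeasurable
  refine measure_ext_of_moments ?_ (ae_mem_Icc_betaMeasure _ _) fun k => ?_
  · rw [ae_map_iff hmeas.aemeasurable
      (show MeasurableSet {y : ℝ | y ∈ Set.Icc (0 : ℝ) 1} from measurableSet_Icc)]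
    refine Eventually.of_forall fun x => ⟨?_, ?_⟩
    · have := hD0 x.fst x.snd
      positivity
    · rw [hn]
      exact div_le_one_of_le₀ (hD1 _ _) (by positivity)
  rw [integral_pow_betaMeasure (by positivity) hb, integral_map hmeas.aemeasurable (by fun_prop)]
  -- The moment of the normalized determinant is the moment of the determinant divided by that of
  -- the norm, direction and norm being independent.
  have hhom := integral_pow_eq_mul_of_homogeneous hcont
    (fun r x => by
      have := hD4 r x.fst x.snd
      change 4 * D (r • x.fst) (r • x.snd) = _
      rw [this]; ring) k
  have hdet : ∫ x : (WithLp 2 (V × V)), (4 * D x.fst x.snd) ^ k ∂(stdGaussian (WithLp 2 (V × V))) =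
      4 ^ k * (2 ^ k * Real.Gamma (M / 2 + k) / Real.Gamma (M / 2)) *
      (2 ^ k * Real.Gamma (p / 2 + k) / Real.Gamma (p / 2)) := by
    rw [← stdGaussian_withLp_prod, integral_map (by fun_prop)
      (hcont.measurable.pow_const k).aestronglyMeasurable]
    have hDk : Continuous fun x : V × V => (4 * D x.1 x.2) ^ k := (continuous_const.mul hD).pow k
    -- With `u` fixed, the projection of `v` is standard Gaussian on a space of dimension `p`, so
    -- its moments do not depend on which projection `u` selects.
    have hin : ∀ᵐ u ∂(stdGaussian V), ∫ v, (4 * D u v) ^ k ∂(stdGaussian V) =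
        4 ^ k * (2 ^ k * Real.Gamma (p / 2 + k) / Real.Gamma (p / 2)) * ‖u‖ ^ (2 * k) := by
      have hne : ∀ᵐ u ∂(stdGaussian V), 0 < ‖u‖ :=
        ae_of_ae_map measurable_norm.aemeasurable (ae_norm_pos V)
      filter_upwards [hne] with u hu
      obtain ⟨T, hT, hDT⟩ := hproj u (norm_pos_iff.1 hu)
      have : Nontrivial T := Module.nontrivial_of_finrank_pos (R := ℝ) (hT ▸ hp)
      have h1 := integral_norm_pow_orthogonalProjection T k
      rw [hT] at h1
      rw [← h1, mul_right_comm, ← integral_const_mul]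
      congr 1
      funext v
      rw [hDT, mul_pow, mul_pow, ← pow_mul, ← pow_mul]
      ring
    -- Integrability for Fubini follows from the bound of `4 * D` by the fourth power of the norm of
    -- the pair.
    have hInt : Integrable (fun x : V × V => (4 * D x.1 x.2) ^ k)
        ((stdGaussian V).prod (stdGaussian V)) := by
      have hp2 : IsProbabilityMeasure ((stdGaussian V).prod (stdGaussian V)) := inferInstance
      have hEint := (integral_norm_pow_stdGaussian (WithLp 2 (V × V)) (2 * k)).1
      rw [← stdGaussian_withLp_prod, integrable_map_measure (by fun_prop) (by fun_prop)] at hEint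
      refine hEint.mono' hDk.measurable.aestronglyMeasurable (Eventually.of_forall fun x => ?_)
      have h0 := hD0 x.1 x.2
      rw [Real.norm_of_nonneg (by positivity)]
      have h4 : ‖(WithLp.toLp 2 x : (WithLp 2 (V × V)))‖ ^ (2 * (2 * k)) = (‖(WithLp.toLp 2 x : (WithLp 2 (V × V)))‖ ^ 4) ^ k := by
        rw [← pow_mul]; congr 1; ring
      simp only [Function.comp_apply]
      rw [h4, hn]
      gcongr
      exact hD1 _ _
    change ∫ x : V × V, (4 * D x.1 x.2) ^ k ∂((stdGaussian V).prod (stdGaussian V)) = _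
    rw [integral_prod _ hInt, integral_congr_ae hin, integral_const_mul,
      (integral_norm_pow_stdGaussian V k).2]
    ring
  have hnorm := (integral_norm_pow_stdGaussian (WithLp 2 (V × V)) (2 * k)).2
  rw [hE, show ((2 * M : ℕ) : ℝ) / 2 = M by push_cast; ring] at hnorm
  have hdup := gamma_duplication_ratio (M := M) (p := p) (by positivity) (by positivity) hb hpb k
  rw [hdet, hnorm, hdup] at hhom
  have hpos : 0 < 2 ^ (2 * k) * Real.Gamma (M + (2 * k : ℕ)) / Real.Gamma (M : ℝ) := by
    have h1 := Real.Gamma_pos_of_pos (by positivity : (0 : ℝ) < M + (2 * k : ℕ))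
    have h2 := Real.Gamma_pos_of_pos (by positivity : (0 : ℝ) < M)
    positivity
  exact (mul_right_cancel₀ hpos.ne' hhom).symm

end Gram

/-! ### Pairs of real or complex vectors: Gram determinant and closing vector -/

section Frames

variable {𝕜 : Type} [RCLike 𝕜] {n : ℕ}

lemma real_inner_eq_re (u v : EuclideanSpace 𝕜 (Fin n)) :
    inner ℝ u v = RCLike.re (inner 𝕜 u v) := by
  simp only [PiLp.inner_apply, map_sum]
  rfl

variable (𝕜 n) in
lemma finrank_real_euclideanSpace :
    Module.finrank ℝ (EuclideanSpace 𝕜 (Fin n)) = n * Module.finrank ℝ 𝕜 := by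
  rw [(WithLp.linearEquiv 2 ℝ (Fin n → 𝕜)).finrank_eq, Module.finrank_pi_fintype]
  simp

/-- The Gram determinant of two vectors. -/
noncomputable def gramDet (u v : EuclideanSpace 𝕜 (Fin n)) : ℝ :=
  ‖u‖ ^ 2 * ‖v‖ ^ 2 - ‖inner 𝕜 u v‖ ^ 2

lemma continuous_gramDet :
    Continuous fun x : EuclideanSpace 𝕜 (Fin n) × EuclideanSpace 𝕜 (Fin n) =>
      gramDet x.1 x.2 := by
  unfold gramDet
  fun_prop

lemma gramDet_smul (r : ℝ) (u v : EuclideanSpace 𝕜 (Fin n)) :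
    gramDet (r • u) (r • v) = r ^ 4 * gramDet u v := by
  unfold gramDet
  rw [RCLike.real_smul_eq_coe_smul (K := 𝕜), RCLike.real_smul_eq_coe_smul (K := 𝕜) r v,
    inner_smul_left, inner_smul_right]
  simp only [norm_smul, norm_mul, RCLike.norm_conj, RCLike.norm_ofReal, mul_pow, sq_abs]
  ring

lemma gramDet_nonneg (u v : EuclideanSpace 𝕜 (Fin n)) : 0 ≤ gramDet u v := by
  have h := norm_inner_le_norm (𝕜 := 𝕜) u v
  have h2 : ‖inner 𝕜 u v‖ ^ 2 ≤ (‖u‖ * ‖v‖) ^ 2 := by gcongr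
  unfold gramDet
  rw [mul_pow] at h2
  linarith

/-- The subtracted term is `closure2 ^ 2`, so the Gram determinant measures how far the polygon is
from closing. -/
lemma four_mul_gramDet (u v : EuclideanSpace 𝕜 (Fin n)) :
    4 * gramDet u v = (‖u‖ ^ 2 + ‖v‖ ^ 2) ^ 2 -
      ((‖u‖ ^ 2 - ‖v‖ ^ 2) ^ 2 + 4 * ‖inner 𝕜 u v‖ ^ 2) := by
  unfold gramDet
  ring

/-- Base times height: `T` is the real orthogonal complement of the `𝕜`-line through `u`, and the
component of `v` in it is `v - c • u`. The dimension is stated additively to avoid truncated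
subtraction. -/
lemma exists_gramDet_eq_projection {u : EuclideanSpace 𝕜 (Fin n)} (hu : u ≠ 0) :
    ∃ T : Submodule ℝ (EuclideanSpace 𝕜 (Fin n)),
      Module.finrank ℝ T + Module.finrank ℝ 𝕜 = n * Module.finrank ℝ 𝕜 ∧
      ∀ v, gramDet u v = ‖u‖ ^ 2 * ‖T.orthogonalProjectionOnto v‖ ^ 2 := by
  let f : 𝕜 →ₗ[ℝ] EuclideanSpace 𝕜 (Fin n) :=
    (LinearMap.toSpanSingleton 𝕜 (EuclideanSpace 𝕜 (Fin n)) u).restrictScalars ℝ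
  have hf : ∀ c, f c = c • u := fun c => rfl
  have hinj : Function.Injective f := by
    intro a b hab
    rw [hf, hf] at hab
    exact smul_left_injective 𝕜 hu hab
  refine ⟨(LinearMap.range f)ᗮ, ?_, fun v => ?_⟩
  · rw [← finrank_real_euclideanSpace, ← LinearMap.finrank_range_of_inj hinj, add_comm]
    exact Submodule.finrank_add_finrank_orthogonal _
  · have hu0 : (‖u‖ : ℝ) ≠ 0 := norm_ne_zero_iff.2 hu
    have hu2 : (inner 𝕜 u u : 𝕜) ≠ 0 := inner_self_ne_zero.2 hu
    let c : 𝕜 := inner 𝕜 u v / inner 𝕜 u u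
    have hw : inner 𝕜 u (v - c • u) = 0 := by
      rw [inner_sub_right, inner_smul_right]
      simp only [c]
      field_simp
      simp
    -- Orthogonality over `𝕜` to `u` gives real orthogonality to every `𝕜`-multiple of `u`, the real
    -- inner product being the real part.
    have hproj : (LinearMap.range f)ᗮ.starProjection v = v - c • u := by
      refine Submodule.eq_starProjection_of_mem_orthogonal ?_ ?_
      · rw [Submodule.mem_orthogonal]
        rintro _ ⟨a, rfl⟩
        rw [hf, real_inner_eq_re, inner_smul_left, hw]
        simp
      · rw [Submodule.orthogonal_orthogonal]
        exact ⟨c, by rw [hf]; abel⟩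
    have hn : ‖(LinearMap.range f)ᗮ.orthogonalProjectionOnto v‖ = ‖v - c • u‖ := by
      rw [← hproj]
      rfl
    have hpyth : ‖v‖ ^ 2 = ‖c • u‖ ^ 2 + ‖v - c • u‖ ^ 2 := by
      have h0 : inner 𝕜 (c • u) (v - c • u) = 0 := by rw [inner_smul_left, hw, mul_zero]
      have := norm_add_sq_eq_norm_sq_add_norm_sq_of_inner_eq_zero (𝕜 := 𝕜) _ _ h0
      rw [add_sub_cancel] at this
      rw [sq, sq, sq, this]
    have hc : ‖c • u‖ ^ 2 * ‖u‖ ^ 2 = ‖inner 𝕜 u v‖ ^ 2 := by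
      rw [norm_smul]
      simp only [c]
      rw [norm_div, inner_self_eq_norm_sq_to_K, norm_pow, RCLike.norm_ofReal, abs_norm]
      field_simp
    rw [hn, gramDet, hpyth, ← hc]
    ring

/-- The norm of the closing vector of the polygon attached to a pair of vectors. -/
noncomputable def closure2 (x : WithLp 2 (EuclideanSpace 𝕜 (Fin n) × EuclideanSpace 𝕜 (Fin n))) :
    ℝ :=
  √((‖x.fst‖ ^ 2 - ‖x.snd‖ ^ 2) ^ 2 + 4 * ‖inner 𝕜 x.fst x.snd‖ ^ 2)

local notation "PairSpace" => WithLp 2 (EuclideanSpace 𝕜 (Fin n) × EuclideanSpace 𝕜 (Fin n))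

variable (𝕜 n) in
lemma finrank_pairSpace : Module.finrank ℝ PairSpace = 2 * (n * Module.finrank ℝ 𝕜) := by
  rw [(WithLp.linearEquiv 2 ℝ _).finrank_eq, Module.finrank_prod,
    finrank_real_euclideanSpace, two_mul]

lemma norm_pow_four (x : PairSpace) : ‖x‖ ^ 4 = (‖x.fst‖ ^ 2 + ‖x.snd‖ ^ 2) ^ 2 := by
  rw [← WithLp.prod_norm_sq_eq_of_L2, ← pow_mul]

lemma closure2_eq (x : PairSpace) : closure2 x = √(‖x‖ ^ 4 - 4 * gramDet x.fst x.snd) := by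
  rw [closure2, four_mul_gramDet, norm_pow_four]
  congr 1
  ring

lemma continuous_closure2 : Continuous (closure2 (𝕜 := 𝕜) (n := n)) := by
  have h1 : Continuous fun x : PairSpace => x.fst :=
    continuous_fst.comp (WithLp.prod_continuous_ofLp 2 _ _)
  have h2 : Continuous fun x : PairSpace => x.snd :=
    continuous_snd.comp (WithLp.prod_continuous_ofLp 2 _ _)
  unfold closure2
  fun_prop

lemma closure2_smul (r : ℝ) (x : PairSpace) : closure2 (r • x) = r ^ 2 * closure2 x := by
  rw [closure2_eq, closure2_eq]
  change √(‖r • x‖ ^ 4 - 4 * gramDet (r • x.fst) (r • x.snd)) = _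
  rw [gramDet_smul, norm_smul, mul_pow, Real.norm_eq_abs, show |r| ^ 4 = r ^ 4 by
    rw [show (4 : ℕ) = 2 * 2 by norm_num, pow_mul, sq_abs, pow_mul]]
  rw [show r ^ 4 * ‖x‖ ^ 4 - 4 * (r ^ 4 * gramDet x.fst x.snd) =
    (r ^ 2) ^ 2 * (‖x‖ ^ 4 - 4 * gramDet x.fst x.snd) by ring, Real.sqrt_mul (by positivity),
    Real.sqrt_sq (by positivity)]

/-- Squaring rewrites the cone around closed polygons as an event about the normalized determinant,
whose law is known. -/
lemma closure2_lt_iff {x : PairSpace} (hx : 0 < ‖x‖) {δ : ℝ} (hδ : 0 < δ) :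
    closure2 x < δ * ‖x‖ ^ 2 ↔ 1 - δ ^ 2 < 4 * gramDet x.fst x.snd / ‖x‖ ^ 4 := by
  rw [closure2_eq, Real.sqrt_lt' (by positivity), lt_div_iff₀ (by positivity)]
  constructor <;> intro h <;> nlinarith [h]

/-- The event says that a beta variable exceeds `1 - δ ^ 2`, which has mass of order `(δ ^ 2) ^ b`
with `2 * b = β + 1`. This exponent is 2 for real and 3 for complex pairs, the dimension in which
the closing vector lives. -/
theorem tendsto_stdGaussian_closure2_div (hn : Module.finrank ℝ 𝕜 < n * Module.finrank ℝ 𝕜) :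
    ∃ c : ℝ, 0 < c ∧ Tendsto (fun δ => (stdGaussian PairSpace).real
      {x | closure2 x < δ * ‖x‖ ^ 2} / δ ^ (Module.finrank ℝ 𝕜 + 1)) (𝓝[>] 0) (𝓝 c) := by
  set β := Module.finrank ℝ 𝕜 with hβ
  have hβ0 : 0 < β := Module.finrank_pos
  -- `p` is the real dimension of the complement of a `𝕜`-line.
  obtain ⟨p, hp⟩ : ∃ p, n * β = p + β := ⟨n * β - β, by omega⟩
  have hp0 : 0 < p := by omega
  have hfr := finrank_real_euclideanSpace 𝕜 n
  have hnt : Nontrivial (EuclideanSpace 𝕜 (Fin n)) :=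
    Module.nontrivial_of_finrank_pos (R := ℝ) (by rw [hfr, ← hβ]; omega)
  have hnt2 : Nontrivial PairSpace := (WithLp.equiv 2 _).nontrivial
  -- Forced by `p / 2 + b = (n * β + 1) / 2`.
  set b : ℝ := (β + 1) / 2 with hb
  have hb0 : 0 < b := by positivity
  have hlaw := map_stdGaussian_eq_betaMeasure (V := EuclideanSpace 𝕜 (Fin n)) (D := gramDet)
    continuous_gramDet hp0 hb0
    (by rw [hfr, ← hβ, hp, hb]; push_cast; ring) gramDet_smul
    (fun u hu => by
      obtain ⟨T, hT, hDT⟩ := exists_gramDet_eq_projection hu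
      rw [← hβ] at hT
      exact ⟨T, by omega, hDT⟩) gramDet_nonneg
    (fun u v => by
      rw [four_mul_gramDet]
      have : 0 ≤ (‖u‖ ^ 2 - ‖v‖ ^ 2) ^ 2 + 4 * ‖inner 𝕜 u v‖ ^ 2 := by positivity
      linarith)
  have ha : (0 : ℝ) < p / 2 := by positivity
  refine ⟨1 / (beta (p / 2) b * b), by have := beta_pos ha hb0; positivity, ?_⟩
  have hsq : Tendsto (fun δ : ℝ => δ ^ 2) (𝓝[>] 0) (𝓝[>] 0) := by
    refine tendsto_nhdsWithin_iff.2 ⟨?_, ?_⟩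
    · have : Tendsto (fun δ : ℝ => δ ^ 2) (𝓝 0) (𝓝 (0 ^ 2)) := (continuous_pow 2).tendsto 0
      rw [zero_pow two_ne_zero] at this
      exact this.mono_left nhdsWithin_le_nhds
    · filter_upwards [self_mem_nhdsWithin] with δ (hδ : 0 < δ)
      exact pow_pos hδ 2
  refine ((tendsto_betaMeasure_Ioi_div ha hb0).comp hsq).congr' ?_
  filter_upwards [self_mem_nhdsWithin] with δ (hδ : 0 < δ)
  have hmeas : Measurable fun x : PairSpace => 4 * gramDet x.fst x.snd / ‖x‖ ^ 4 :=
    (continuous_const.mul (continuous_gramDet.comp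
      (WithLp.prod_continuous_ofLp 2 _ _))).measurable.div (measurable_norm.pow_const 4)
  have hne : ∀ᵐ x ∂(stdGaussian PairSpace), 0 < ‖x‖ :=
    ae_of_ae_map measurable_norm.aemeasurable (ae_norm_pos PairSpace)
  simp only [Function.comp_apply]
  congr 1
  · rw [← hlaw, map_measureReal_apply hmeas measurableSet_Ioi, Measure.real, Measure.real]
    congr 1
    refine measure_congr ?_
    filter_upwards [hne] with x hx
    exact propext (closure2_lt_iff hx hδ).symm
  · rw [hb, ← Real.rpow_natCast, ← Real.rpow_mul hδ.le, ← Real.rpow_natCast]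
    congr 1
    push_cast
    ring

/-! ### The action of the unitary group -/

/-- A unitary matrix applied to a vector. -/
noncomputable def unitaryVec (U : Matrix.unitaryGroup (Fin n) 𝕜) (u : EuclideanSpace 𝕜 (Fin n)) :
    EuclideanSpace 𝕜 (Fin n) :=
  WithLp.toLp 2 ((U : Matrix (Fin n) (Fin n) 𝕜).mulVec u.ofLp)

lemma inner_unitaryVec (U : Matrix.unitaryGroup (Fin n) 𝕜) (u v : EuclideanSpace 𝕜 (Fin n)) :
    inner 𝕜 (unitaryVec U u) (unitaryVec U v) = inner 𝕜 u v := by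
  rw [EuclideanSpace.inner_eq_star_dotProduct, EuclideanSpace.inner_eq_star_dotProduct]
  simp only [unitaryVec]
  rw [Matrix.star_mulVec, dotProduct_comm, ← Matrix.dotProduct_mulVec, Matrix.mulVec_mulVec]
  have h : ((U : Matrix (Fin n) (Fin n) 𝕜).conjTranspose * (U : Matrix (Fin n) (Fin n) 𝕜)) = 1 :=
    Matrix.UnitaryGroup.star_mul_self U
  rw [h, Matrix.one_mulVec, dotProduct_comm]

lemma norm_unitaryVec (U : Matrix.unitaryGroup (Fin n) 𝕜) (u : EuclideanSpace 𝕜 (Fin n)) :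
    ‖unitaryVec U u‖ = ‖u‖ := by
  rw [norm_eq_sqrt_re_inner (𝕜 := 𝕜), inner_unitaryVec, ← norm_eq_sqrt_re_inner]

/-- The diagonal action of the unitary group on pairs of vectors. -/
noncomputable def unitaryPair (U : Matrix.unitaryGroup (Fin n) 𝕜) (x : PairSpace) : PairSpace :=
  WithLp.toLp 2 (unitaryVec U x.fst, unitaryVec U x.snd)

lemma unitaryVec_smul (U : Matrix.unitaryGroup (Fin n) 𝕜) (r : ℝ)
    (u : EuclideanSpace 𝕜 (Fin n)) : unitaryVec U (r • u) = r • unitaryVec U u := by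
  simp only [unitaryVec, WithLp.ofLp_smul, Matrix.mulVec_smul, WithLp.toLp_smul]

lemma unitaryVec_add (U : Matrix.unitaryGroup (Fin n) 𝕜)
    (u v : EuclideanSpace 𝕜 (Fin n)) : unitaryVec U (u + v) = unitaryVec U u + unitaryVec U v := by
  simp only [unitaryVec, WithLp.ofLp_add, Matrix.mulVec_add, WithLp.toLp_add]

lemma unitaryPair_smul (U : Matrix.unitaryGroup (Fin n) 𝕜) (r : ℝ) (x : PairSpace) :
    unitaryPair U (r • x) = r • unitaryPair U x := by
  have h1 : (r • x).fst = r • x.fst := rfl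
  have h2 : (r • x).snd = r • x.snd := rfl
  rw [unitaryPair, h1, h2, unitaryVec_smul, unitaryVec_smul]
  rfl

lemma unitaryPair_mul (U U' : Matrix.unitaryGroup (Fin n) 𝕜) (x : PairSpace) :
    unitaryPair (U * U') x = unitaryPair U (unitaryPair U' x) := by
  simp [unitaryPair, unitaryVec, Matrix.mulVec_mulVec]

lemma closure2_unitaryPair (U : Matrix.unitaryGroup (Fin n) 𝕜) (x : PairSpace) :
    closure2 (unitaryPair U x) = closure2 x := by
  change √((‖unitaryVec U x.fst‖ ^ 2 - ‖unitaryVec U x.snd‖ ^ 2) ^ 2 +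
    4 * ‖inner 𝕜 (unitaryVec U x.fst) (unitaryVec U x.snd)‖ ^ 2) = _
  rw [norm_unitaryVec, norm_unitaryVec, inner_unitaryVec]
  rfl

lemma continuous_unitaryPair :
    Continuous fun p : Matrix.unitaryGroup (Fin n) 𝕜 × PairSpace => unitaryPair p.1 p.2 := by
  have h1 : Continuous fun x : PairSpace => x.fst :=
    continuous_fst.comp (WithLp.prod_continuous_ofLp 2 _ _)
  have h2 : Continuous fun x : PairSpace => x.snd :=
    continuous_snd.comp (WithLp.prod_continuous_ofLp 2 _ _)
  have hv : Continuous fun p : Matrix.unitaryGroup (Fin n) 𝕜 × EuclideanSpace 𝕜 (Fin n) =>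
      unitaryVec p.1 p.2 :=
    (PiLp.continuous_toLp 2 _).comp ((continuous_subtype_val.comp continuous_fst).matrix_mulVec
      ((PiLp.continuous_ofLp 2 _).comp continuous_snd))
  exact (WithLp.prod_continuous_toLp 2 _ _).comp
    ((hv.comp (continuous_fst.prodMk (h1.comp continuous_snd))).prodMk
      (hv.comp (continuous_fst.prodMk (h2.comp continuous_snd))))

lemma stdGaussian_map_unitaryPair (U : Matrix.unitaryGroup (Fin n) 𝕜) :
    (stdGaussian PairSpace).map (unitaryPair U) = stdGaussian PairSpace := by
  let L : PairSpace →ₗᵢ[ℝ] PairSpace :=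
    { toFun := unitaryPair U
      map_add' := fun x y => by
        have h1 : (x + y).fst = x.fst + y.fst := rfl
        have h2 : (x + y).snd = x.snd + y.snd := rfl
        rw [unitaryPair, h1, h2, unitaryVec_add, unitaryVec_add]
        rfl
      map_smul' := fun r x => unitaryPair_smul U r x
      norm_map' := fun x => by
        change ‖unitaryPair U x‖ = ‖x‖
        rw [← sq_eq_sq₀ (norm_nonneg _) (norm_nonneg _), WithLp.prod_norm_sq_eq_of_L2,
          WithLp.prod_norm_sq_eq_of_L2]
        change ‖unitaryVec U x.fst‖ ^ 2 + ‖unitaryVec U x.snd‖ ^ 2 = _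
        rw [norm_unitaryVec, norm_unitaryVec] }
  exact stdGaussian_map (L.toLinearIsometryEquiv rfl)

variable (𝕜) in
/-- The reference frame. -/
noncomputable def baseFrame (hn : 2 ≤ n) : PairSpace :=
  WithLp.toLp 2
    (EuclideanSpace.single (Fin.castLE hn 0) 1, EuclideanSpace.single (Fin.castLE hn 1) 1)

lemma unitaryPair_baseFrame (hn : 2 ≤ n) (U : Matrix.unitaryGroup (Fin n) 𝕜) :
    unitaryPair U (baseFrame 𝕜 hn) = WithLp.toLp 2 (frame 𝕜 hn U).1 := by
  have h : ∀ k : Fin n, unitaryVec U (EuclideanSpace.single k 1) =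
      WithLp.toLp 2 fun m => (U : Matrix (Fin n) (Fin n) 𝕜) m k := by
    intro k
    ext m
    simp [unitaryVec]
  exact congrArg (WithLp.toLp 2) (Prod.ext (h _) (h _))

/-- An orthonormal pair extends to an orthonormal basis, whose vectors are the columns of a unitary
matrix. -/
lemma frame_surjective (hn : 2 ≤ n) : Function.Surjective (frame 𝕜 hn) := by
  rintro ⟨⟨u, v⟩, hu, hv, huv⟩
  simp only at hu hv huv
  set i₀ : Fin n := Fin.castLE hn 0
  set i₁ : Fin n := Fin.castLE hn 1
  have hne : i₁ ≠ i₀ := by simp [i₀, i₁, Fin.ext_iff]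
  -- Only the values at `i₀` and `i₁` matter; orthonormality is asked of the restriction to these
  -- two indices.
  let w : Fin n → EuclideanSpace 𝕜 (Fin n) := fun i => if i = i₀ then u else v
  have hw0 : w i₀ = u := if_pos rfl
  have hw1 : w i₁ = v := if_neg hne
  have horth : Orthonormal 𝕜 (({i₀, i₁} : Set (Fin n)).domRestrict w) := by
    refine ⟨?_, ?_⟩
    · rintro ⟨i, rfl | rfl⟩
      · simpa [hw0] using hu
      · simpa [hw1] using hv
    · rintro ⟨i, rfl | rfl⟩ ⟨j, rfl | rfl⟩ hij
      · exact absurd rfl hij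
      · simpa [hw0, hw1] using huv
      · simpa [hw0, hw1] using inner_eq_zero_symm.1 huv
      · exact absurd rfl hij
  obtain ⟨b, hb⟩ := horth.exists_orthonormalBasis_extension_of_card_eq (by simp)
  let U : Matrix.unitaryGroup (Fin n) 𝕜 :=
    ⟨_, (EuclideanSpace.basisFun (Fin n) 𝕜).toMatrix_orthonormalBasis_mem_unitary b⟩
  have hU : ∀ i j, (U : Matrix (Fin n) (Fin n) 𝕜) i j = b j i := fun i j => by
    simp [U, Module.Basis.toMatrix_apply]
  refine ⟨U, Subtype.ext (Prod.ext ?_ ?_)⟩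
  · ext m
    change (U : Matrix (Fin n) (Fin n) 𝕜) m i₀ = u m
    rw [hU, hb i₀ (by simp), hw0]
  · ext m
    change (U : Matrix (Fin n) (Fin n) 𝕜) m i₁ = v m
    rw [hU, hb i₁ (by simp), hw1]

/-- Vanishing of `closure2` forces `‖u‖ = ‖v‖` and `u ⟂ v`; as the pair has norm 1, each vector has
norm `1 / √2`, and the pair is a frame scaled by that factor. -/
lemma exists_unitaryPair_eq (hn : 2 ≤ n) {x : PairSpace} (hx : ‖x‖ = 1) (hq : closure2 x = 0) :
    ∃ U : Matrix.unitaryGroup (Fin n) 𝕜, unitaryPair U ((√2)⁻¹ • baseFrame 𝕜 hn) = x := by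
  have h1 : ‖x.fst‖ ^ 2 + ‖x.snd‖ ^ 2 = 1 := by
    rw [← WithLp.prod_norm_sq_eq_of_L2, hx, one_pow]
  rw [closure2, Real.sqrt_eq_zero (by positivity)] at hq
  have h2 : ‖x.fst‖ ^ 2 = ‖x.snd‖ ^ 2 := by
    have : (‖x.fst‖ ^ 2 - ‖x.snd‖ ^ 2) ^ 2 = 0 := by
      nlinarith [sq_nonneg (‖x.fst‖ ^ 2 - ‖x.snd‖ ^ 2), sq_nonneg ‖inner 𝕜 x.fst x.snd‖]
    exact sub_eq_zero.1 (pow_eq_zero_iff two_ne_zero |>.1 this)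
  have h3 : inner 𝕜 x.fst x.snd = 0 := by
    rw [← norm_eq_zero, ← pow_eq_zero_iff two_ne_zero]
    nlinarith [sq_nonneg (‖x.fst‖ ^ 2 - ‖x.snd‖ ^ 2), sq_nonneg ‖inner 𝕜 x.fst x.snd‖]
  have hs2 : (√2 : ℝ) ^ 2 = 2 := Real.sq_sqrt (by norm_num)
  have hn1 : ∀ u : EuclideanSpace 𝕜 (Fin n), ‖u‖ ^ 2 = 1 / 2 → ‖√2 • u‖ = 1 := by
    intro u hu
    rw [← sq_eq_sq₀ (norm_nonneg _) zero_le_one, norm_smul, mul_pow, hu, Real.norm_eq_abs, sq_abs,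
      hs2]
    norm_num
  obtain ⟨U, hU⟩ := frame_surjective (𝕜 := 𝕜) hn
    ⟨(√2 • x.fst, √2 • x.snd), hn1 _ (by linarith), hn1 _ (by linarith), by
      simp only
      rw [RCLike.real_smul_eq_coe_smul (K := 𝕜), RCLike.real_smul_eq_coe_smul (K := 𝕜) _ x.snd,
        inner_smul_left, inner_smul_right, h3]
      simp⟩
  refine ⟨U, ?_⟩
  rw [unitaryPair_smul, unitaryPair_baseFrame, hU]
  have h2ne : (√2 : ℝ) ≠ 0 := by positivity
  change (√2)⁻¹ • (√2 • x) = x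
  rw [smul_smul, inv_mul_cancel₀ h2ne, one_smul]

variable (𝕜 n) in
/-- The Haar probability measure on the unitary (orthogonal) group. -/
noncomputable abbrev unitaryHaar : Measure (Matrix.unitaryGroup (Fin n) 𝕜) :=
  Measure.haarMeasure (⊤ : TopologicalSpace.PositiveCompacts (Matrix.unitaryGroup (Fin n) 𝕜))

instance : IsProbabilityMeasure (unitaryHaar 𝕜 n) :=
  ⟨Measure.haarMeasure_self (K₀ := (⊤ : TopologicalSpace.PositiveCompacts
    (Matrix.unitaryGroup (Fin n) 𝕜)))⟩

/-- A right translate of Haar measure is again a Haar probability measure, hence the same one. -/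
instance : (unitaryHaar 𝕜 n).IsMulRightInvariant where
  map_mul_right_eq_self g := by
    have h1 : ((unitaryHaar 𝕜 n).map fun x => x * g).IsHaarMeasure :=
      inferInstanceAs ((unitaryHaar 𝕜 n).map fun x => MulOpposite.op g • x).IsHaarMeasure
    have h2 : IsProbabilityMeasure ((unitaryHaar 𝕜 n).map fun x => x * g) :=
      Measure.isProbabilityMeasure_map (by fun_prop)
    exact Measure.isHaarMeasure_eq_of_isProbabilityMeasure _ _

/-- The conditional law of a Gaussian pair of vectors, given that the closing vector is small,
converges to the law of a random multiple of a Haar random frame. -/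
theorem exists_tendsto_integral_cond_closure2 (hn : 2 ≤ n)
    (hdim : Module.finrank ℝ 𝕜 + 1 < n * Module.finrank ℝ 𝕜) :
    ∃ ρ : Measure ℝ, IsProbabilityMeasure ρ ∧ (∀ᵐ r ∂ρ, 0 < r) ∧ ∀ h : PairSpace →ᵇ ℝ,
      Tendsto (fun ε => ∫ x, h x ∂(ProbabilityTheory.cond (stdGaussian PairSpace)
        {x | closure2 x < ε})) (𝓝[>] 0)
        (𝓝 (∫ r, ∫ U, h ((r * (√2)⁻¹) • WithLp.toLp 2 (frame 𝕜 hn U).1)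
          ∂(unitaryHaar 𝕜 n) ∂ρ)) := by
  have hfr := finrank_pairSpace 𝕜 n
  have hnt : Nontrivial PairSpace :=
    Module.nontrivial_of_finrank_pos (R := ℝ) (by rw [hfr]; omega)
  obtain ⟨c, hc, hm⟩ := tendsto_stdGaussian_closure2_div (𝕜 := 𝕜) (n := n) (by omega)
  -- Here `d = β + 1` and the real dimension is `2 * n * β`, so the dimension condition is twice
  -- `hdim`.
  obtain ⟨ρ, h1, h2, h3⟩ := exists_tendsto_integral_cond (η := unitaryHaar 𝕜 n)
    continuous_unitaryPair stdGaussian_map_unitaryPair unitaryPair_mul unitaryPair_smul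
    continuous_closure2 (fun x => Real.sqrt_nonneg _) closure2_smul closure2_unitaryPair
    (fun x hx hq => exists_unitaryPair_eq hn hx hq) hc hm (by rw [hfr]; omega)
  refine ⟨ρ, h1, h2, fun h => ?_⟩
  simpa only [unitaryPair_smul, unitaryPair_baseFrame, smul_smul] using h3 h

end Frames

/-! ### Subspace measures -/

lemma measurableEmbedding_coe_polygons (d n : ℕ) :
    MeasurableEmbedding ((↑) : Polygons d n → Arms d n) :=
  MeasurableEmbedding.subtype_coe (Polygons d n).closed_of_finiteDimensional.measurableSet

/-- Limits of integrals are unique, bounded continuous functions determine finite measures, and the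
inclusion is a measurable embedding, so `ν` is recovered from its image. -/
theorem IsSubspaceMeasure.unique {d n : ℕ} {μ : Measure (Arms d n)} {ν ν' : Measure (Polygons d n)}
    (h : IsSubspaceMeasure μ ν) (h' : IsSubspaceMeasure μ ν') : ν = ν' := by
  have := h.1
  have := h'.1
  have hemb := measurableEmbedding_coe_polygons d n
  have hmap : ν.map ((↑) : Polygons d n → Arms d n) = ν'.map ((↑) : Polygons d n → Arms d n) := by
    have := Measure.isProbabilityMeasure_map (μ := ν) hemb.measurable.aemeasurable
    have := Measure.isProbabilityMeasure_map (μ := ν') hemb.measurable.aemeasurable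
    refine ext_of_forall_integral_eq_of_IsFiniteMeasure fun f => ?_
    rw [hemb.integral_map, hemb.integral_map]
    exact tendsto_nhds_unique (h.2 f) (h'.2 f)
  rw [← hemb.comap_map ν, hmap, hemb.comap_map]

theorem IsSubspaceMeasure.subspaceMeasure_eq {d n : ℕ} {μ : Measure (Arms d n)}
    {ν : Measure (Polygons d n)} (h : IsSubspaceMeasure μ ν) : subspaceMeasure μ = ν := by
  have hex : ∃ ν : Measure (Polygons d n), IsSubspaceMeasure μ ν := ⟨ν, h⟩
  rw [subspaceMeasure, dif_pos hex]
  exact hex.choose_spec.unique h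

lemma continuous_totalLength (d n : ℕ) : Continuous fun e : Arms d n => ∑ i, ‖e i‖ := by
  fun_prop

lemma totalLength_smul {d n : ℕ} {t : ℝ} (ht : 0 < t) (e : Arms d n) :
    ∑ i, ‖(t • e) i‖ = t * ∑ i, ‖e i‖ := by
  simp [norm_smul, Finset.mul_sum, abs_of_pos ht]

/-- The total length of a closed polygon. -/
noncomputable def polygonLength {d n : ℕ} (p : Polygons d n) : ℝ := ∑ i, ‖(p : Arms d n) i‖

lemma continuous_polygonLength (d n : ℕ) : Continuous (polygonLength (d := d) (n := n)) :=
  (continuous_totalLength d n).comp continuous_subtype_val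

lemma polygonLength_smul {d n : ℕ} {t : ℝ} (ht : 0 < t) (p : Polygons d n) :
    polygonLength (t • p) = t * polygonLength p :=
  totalLength_smul ht (p : Arms d n)

lemma cond_map_eq {α β : Type*} [MeasurableSpace α] [MeasurableSpace β] {κ : Measure α} {f : α → β}
    (hf : Measurable f) {s : Set β} (hs : MeasurableSet s) :
    ProbabilityTheory.cond (κ.map f) s = (ProbabilityTheory.cond κ (f ⁻¹' s)).map f := by
  rw [ProbabilityTheory.cond, ProbabilityTheory.cond, Measure.map_apply hf hs,
    Measure.restrict_map hf hs, Measure.map_smul]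

/-- The image of a Gaussian vector under a quadratic map is a random multiple of the image of a
uniform random point on a sphere. -/
lemma map_stdGaussian_eq_map_prod {E : Type*} [NormedAddCommGroup E] [InnerProductSpace ℝ E]
    [FiniteDimensional ℝ E] [MeasurableSpace E] [BorelSpace E] [Nontrivial E]
    {V : Type*} [AddCommGroup V] [Module ℝ V] [MeasurableSpace V] [MeasurableSMul₂ ℝ V]
    {S : Set V} {h : E → V} (hh : Measurable h) (hh2 : ∀ (r : ℝ) x, h (r • x) = r ^ 2 • h x)
    {φ : Metric.sphere (0 : E) 1 → S} (hφ : Measurable φ) (hφh : ∀ x, (φ x : V) = h (√2 • (x : E))) :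
    (stdGaussian E).map h = (((sphereProb E).map φ).prod
      (((stdGaussian E).map norm).map fun r => r ^ 2 / 2)).map fun p => p.2 • (p.1 : V) := by
  have hρ : IsProbabilityMeasure ((stdGaussian E).map norm) :=
    Measure.isProbabilityMeasure_map measurable_norm.aemeasurable
  have hψ : Measurable fun r : ℝ => r ^ 2 / 2 := by fun_prop
  have hM : Measurable fun p : Metric.sphere (0 : E) 1 × ℝ => p.2 • (p.1 : E) := by fun_prop
  have hM' : Measurable fun p : S × ℝ => p.2 • (p.1 : V) :=
    measurable_snd.smul (measurable_subtype_coe.comp measurable_fst)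
  rw [Measure.map_prod_map _ _ hφ hψ, Measure.map_map hM' (hφ.prodMap hψ)]
  conv_lhs => rw [stdGaussian_eq_map_prod, Measure.map_map hh hM]
  congr 1
  funext p
  -- The symmetric model has radius `√2`, so radius `r` becomes dilation by `r ^ 2 / 2`: `h (r • x)
  -- = (r ^ 2 / 2) • h (√2 • x)`.
  simp only [Function.comp_apply, Prod.map_fst, Prod.map_snd, hφh, hh2, smul_smul]
  rw [Real.sq_sqrt (by norm_num)]
  congr 1
  ring

lemma measurableSet_pol (d n : ℕ) : MeasurableSet (Pol d n) :=
  IsClosed.measurableSet (isClosed_eq (continuous_polygonLength d n) continuous_const)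

lemma polygonLength_eq_two {d n : ℕ} : ∀ p ∈ Pol d n, polygonLength p = 2 := fun _ hp => hp

lemma integrable_iff_and_integral_eq_of_length {d n : ℕ} {σ : Measure (Pol d n)}
    [IsProbabilityMeasure σ] {τ : Measure ℝ} [IsProbabilityMeasure τ] (hτ : ∀ᵐ t ∂τ, 0 < t)
    {H : Measure (Polygons d n)}
    (hH : H = (σ.prod τ).map fun p : Pol d n × ℝ => p.2 • (p.1 : Polygons d n))
    {F : Polygons d n → ℝ} (hF : ScaleInvariant F) (hPol : MeasurableSet (Pol d n))
    {len : Polygons d n → ℝ} (hlen : Measurable len)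
    (hsmul : ∀ t : ℝ, 0 < t → ∀ p : Polygons d n, len (t • p) = t * len p)
    (hlen2 : ∀ p ∈ Pol d n, len p = 2) :
    (Integrable F H ↔ Integrable (fun p : Pol d n => F p) σ) ∧
      ∫ p, F p ∂H = ∫ p : Pol d n, F p ∂σ :=
  ScaleInvariant.integrable_iff_and_integral_eq (V := Polygons d n) (S := Pol d n) (F := F)
    (σ := σ) (τ := τ) hPol hτ hlen hsmul hlen2 hH hF

theorem integrable_iff_and_integral_eq_of_polygons {d n : ℕ} {σ : Measure (Pol d n)}
    [IsProbabilityMeasure σ] {τ : Measure ℝ} [IsProbabilityMeasure τ] (hτ : ∀ᵐ t ∂τ, 0 < t)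
    {H : Measure (Polygons d n)}
    (hH : H = (σ.prod τ).map fun p : Pol d n × ℝ => p.2 • (p.1 : Polygons d n))
    {F : Polygons d n → ℝ} (hF : ScaleInvariant F) :
    (Integrable F H ↔ Integrable (fun p : Pol d n => F p) σ) ∧
      ∫ p, F p ∂H = ∫ p : Pol d n, F p ∂σ := by
  have h1 := (continuous_polygonLength d n).measurable
  have h2 : ∀ t : ℝ, 0 < t → ∀ p : Polygons d n, polygonLength (t • p) = t * polygonLength p :=
    fun t ht p => polygonLength_smul ht p
  exact integrable_iff_and_integral_eq_of_length hτ hH hF (measurableSet_pol d n) h1 h2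
    polygonLength_eq_two

/-- A quadratic map turns the polar decomposition into a positive dilation independent of a polygon
of length 2, to which scale invariance applies. -/
theorem arm_of_quadratic {d n : ℕ} {E : Type*} [NormedAddCommGroup E] [InnerProductSpace ℝ E]
    [FiniteDimensional ℝ E] [MeasurableSpace E] [BorelSpace E] [Nontrivial E]
    {h : E → Arms d n} (hh : Measurable h) (hh2 : ∀ (r : ℝ) x, h (r • x) = r ^ 2 • h x)
    {φ : Metric.sphere (0 : E) 1 → Arm d n} (hφh : ∀ x, (φ x : Arms d n) = h (√2 • (x : E)))
    {F : Arms d n → ℝ} (hF : ScaleInvariant F) :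
    (Integrable F ((stdGaussian E).map h) ↔
      Integrable (fun e : Arm d n => F e) ((sphereProb E).map φ)) ∧
    ∫ e, F e ∂((stdGaussian E).map h) = ∫ e : Arm d n, F e ∂((sphereProb E).map φ) := by
  have hφ : Measurable φ := by
    have : Measurable fun x => (φ x : Arms d n) := by
      simp_rw [hφh]
      exact hh.comp (by fun_prop)
    exact this.subtype_mk (h := fun x => (φ x).2)
  have hρ : IsProbabilityMeasure ((stdGaussian E).map norm) :=
    Measure.isProbabilityMeasure_map measurable_norm.aemeasurable
  have hσ : IsProbabilityMeasure ((sphereProb E).map φ) :=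
    Measure.isProbabilityMeasure_map hφ.aemeasurable
  have hψ : Measurable fun r : ℝ => r ^ 2 / 2 := by fun_prop
  have hτ : IsProbabilityMeasure (((stdGaussian E).map norm).map fun r => r ^ 2 / 2) :=
    Measure.isProbabilityMeasure_map hψ.aemeasurable
  have hτ0 : ∀ᵐ t ∂(((stdGaussian E).map norm).map fun r => r ^ 2 / 2), 0 < t := by
    rw [ae_map_iff hψ.aemeasurable (show MeasurableSet {r : ℝ | 0 < r} from measurableSet_Ioi)]
    filter_upwards [ae_norm_pos E] with r hr
    positivity
  have hArm : MeasurableSet (Arm d n) :=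
    (isClosed_eq (continuous_totalLength d n) continuous_const).measurableSet
  exact hF.integrable_iff_and_integral_eq hArm hτ0
    (continuous_totalLength d n).measurable (fun t ht e => totalLength_smul ht e) (fun e he => he)
    (map_stdGaussian_eq_map_prod hh hh2 hφ hφh)

/-! ### Closed polygons as quadratic images of Gaussian pairs -/

section

variable {𝕜 : Type} [RCLike 𝕜] {n : ℕ}

local notation "PairSpace" => WithLp 2 (EuclideanSpace 𝕜 (Fin n) × EuclideanSpace 𝕜 (Fin n))

lemma continuous_frame (hn : 2 ≤ n) : Continuous (frame 𝕜 hn) := by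
  refine Continuous.subtype_mk (Continuous.prodMk ?_ ?_) _
  all_goals
    refine (PiLp.continuous_toLp 2 _).comp (continuous_pi fun m => ?_)
    exact (continuous_apply _).comp ((continuous_apply m).comp continuous_subtype_val)

instance (hn : 2 ≤ n) : IsProbabilityMeasure (stiefelHaar 𝕜 hn) :=
  Measure.isProbabilityMeasure_map (continuous_frame hn).measurable.aemeasurable

/-- The closed-polygon analogue of the polar decomposition: the Gaussian law conditioned on closure
is the law of a random multiple of the polygon of a Haar random frame. -/
theorem exists_isSubspaceMeasure {d : ℕ} (hn : 2 ≤ n)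
    (hdim : Module.finrank ℝ 𝕜 + 1 < n * Module.finrank ℝ 𝕜)
    {h : PairSpace → Arms d n} (hh : Continuous h) (hh2 : ∀ (r : ℝ) x, h (r • x) = r ^ 2 • h x)
    (hclose : ∀ x, ‖∑ i, h x i‖ = closure2 x)
    {φ : Stiefel 𝕜 n → Pol d n} (hφ : Measurable φ)
    (hφh : ∀ p, ((φ p : Polygons d n) : Arms d n) = h (WithLp.toLp 2 p.1)) :
    ∃ τ : Measure ℝ, IsProbabilityMeasure τ ∧ (∀ᵐ t ∂τ, 0 < t) ∧
      IsSubspaceMeasure ((stdGaussian PairSpace).map h)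
        ((((stiefelHaar 𝕜 hn).map φ).prod τ).map
          fun p : Pol d n × ℝ => p.2 • (p.1 : Polygons d n)) := by
  obtain ⟨ρ, hρ, hρ0, hlim⟩ := exists_tendsto_integral_cond_closure2 (𝕜 := 𝕜) hn hdim
  have hψ : Measurable fun r : ℝ => r ^ 2 / 2 := by fun_prop
  have hτ : IsProbabilityMeasure (ρ.map fun r => r ^ 2 / 2) :=
    Measure.isProbabilityMeasure_map hψ.aemeasurable
  have hσ : IsProbabilityMeasure ((stiefelHaar 𝕜 hn).map φ) :=
    Measure.isProbabilityMeasure_map hφ.aemeasurable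
  have hM : Measurable fun p : Pol d n × ℝ => p.2 • (p.1 : Polygons d n) :=
    measurable_snd.smul (measurable_subtype_coe.comp measurable_fst)
  -- A frame has norm `√2` as a pair, so the limiting vector is `r / √2` times a frame, and the
  -- quadratic map sends it to `r ^ 2 / 2` times the polygon of the frame.
  refine ⟨ρ.map fun r => r ^ 2 / 2, hτ, ?_, Measure.isProbabilityMeasure_map hM.aemeasurable,
    fun f => ?_⟩
  · rw [ae_map_iff hψ.aemeasurable (show MeasurableSet {r : ℝ | 0 < r} from measurableSet_Ioi)]
    filter_upwards [hρ0] with r hr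
    positivity
  have hval : ∫ r, ∫ U, f (h ((r * (√2)⁻¹) • WithLp.toLp 2 (frame 𝕜 hn U).1))
      ∂(unitaryHaar 𝕜 n) ∂ρ = ∫ p : Polygons d n, f (p : Arms d n)
        ∂((((stiefelHaar 𝕜 hn).map φ).prod (ρ.map fun r => r ^ 2 / 2)).map
          fun p : Pol d n × ℝ => p.2 • (p.1 : Polygons d n)) := by
    have hfm : StronglyMeasurable fun p : Polygons d n => f (p : Arms d n) :=
      (f.continuous.comp continuous_subtype_val).measurable.stronglyMeasurable
    have hfm2 : StronglyMeasurable fun p : Pol d n × ℝ =>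
        f ((p.2 • (p.1 : Polygons d n) : Polygons d n) : Arms d n) := hfm.comp_measurable hM
    rw [integral_map hM.aemeasurable hfm.aestronglyMeasurable, integral_prod_symm]
    · rw [integral_map hψ.aemeasurable hfm2.integral_prod_left.aestronglyMeasurable]
      refine integral_congr_ae (Eventually.of_forall fun r => ?_)
      simp only
      have hm1 : Measurable fun p : Pol d n =>
          f (((r ^ 2 / 2) • (p : Polygons d n) : Polygons d n) : Arms d n) :=
        (f.continuous.comp (continuous_subtype_val.comp
          (continuous_subtype_val.const_smul (r ^ 2 / 2)))).measurable
      have hm2 : Measurable fun p : Stiefel 𝕜 n =>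
          f (((r ^ 2 / 2) • (φ p : Polygons d n) : Polygons d n) : Arms d n) := hm1.comp hφ
      rw [integral_map hφ.aemeasurable hm1.aestronglyMeasurable, stiefelHaar,
        integral_map (continuous_frame hn).measurable.aemeasurable hm2.aestronglyMeasurable]
      refine integral_congr_ae (Eventually.of_forall fun U => ?_)
      simp only [Submodule.coe_smul]
      rw [hh2, hφh, mul_pow, inv_pow, Real.sq_sqrt (by norm_num), div_eq_mul_inv]
    · exact Integrable.of_bound hfm2.aestronglyMeasurable ‖f‖
        (Eventually.of_forall fun p => f.norm_coe_le_norm _)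
  rw [← hval]
  -- `f ∘ h` is a bounded continuous test function on pairs; conditioning commutes with the
  -- pushforward by `h`, and `hclose` identifies the conditioning events.
  refine (hlim (f.compContinuous ⟨h, hh⟩)).congr fun ε => ?_
  have hs : MeasurableSet {e : Arms d n | ‖∑ i, e i‖ < ε} :=
    (isOpen_lt (by fun_prop) continuous_const).measurableSet
  have hpre : h ⁻¹' {e : Arms d n | ‖∑ i, e i‖ < ε} = {x | closure2 x < ε} :=
    Set.ext fun x => by
      change ‖∑ i, h x i‖ < ε ↔ closure2 x < ε
      rw [hclose]
  rw [cond_map_eq hh.measurable hs, integral_map hh.measurable.aemeasurable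
    f.continuous.measurable.aestronglyMeasurable, hpre]
  rfl

/-- By uniqueness, the chosen `subspaceMeasure` is the limit law already found, a random dilation of
the image of Haar measure, so scale invariance applies as for open polygons. -/
theorem pol_of_quadratic {d : ℕ} (hn : 2 ≤ n)
    (hdim : Module.finrank ℝ 𝕜 + 1 < n * Module.finrank ℝ 𝕜)
    {h : PairSpace → Arms d n} (hh : Continuous h) (hh2 : ∀ (r : ℝ) x, h (r • x) = r ^ 2 • h x)
    (hclose : ∀ x, ‖∑ i, h x i‖ = closure2 x)
    {φ : Stiefel 𝕜 n → Pol d n} (hφh : ∀ p, ((φ p : Polygons d n) : Arms d n) = h (WithLp.toLp 2 p.1))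
    {μ : Measure (Arms d n)} (hμ : μ = (stdGaussian PairSpace).map h) :
    IsSubspaceMeasure μ (subspaceMeasure μ) ∧
    ∀ F : Polygons d n → ℝ, ScaleInvariant F →
      (Integrable F (subspaceMeasure μ) ↔
        Integrable (fun p : Pol d n => F p) ((stiefelHaar 𝕜 hn).map φ)) ∧
      ∫ p, F p ∂(subspaceMeasure μ) = ∫ p : Pol d n, F p ∂((stiefelHaar 𝕜 hn).map φ) := by
  have hφ : Measurable φ := by
    have hc : Continuous fun p => ((φ p : Polygons d n) : Arms d n) := by
      simp_rw [hφh]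
      exact hh.comp ((WithLp.prod_continuous_toLp 2 _ _).comp continuous_subtype_val)
    exact ((hc.subtype_mk fun p => (φ p).1.2).subtype_mk fun p => (φ p).2).measurable
  have hσ : IsProbabilityMeasure ((stiefelHaar 𝕜 hn).map φ) :=
    Measure.isProbabilityMeasure_map hφ.aemeasurable
  obtain ⟨τ, hτ, hτ0, hsub⟩ := exists_isSubspaceMeasure hn hdim hh hh2 hclose hφ hφh
  rw [← hμ] at hsub
  have heq := hsub.subspaceMeasure_eq
  exact ⟨heq ▸ hsub, fun F hF => integrable_iff_and_integral_eq_of_polygons hτ0 heq hF⟩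

lemma stdGaussian_map_pair {ι : Type} [Fintype ι] {f : EuclideanSpace ℝ ι → PairSpace}
    (hadd : ∀ x y, f (x + y) = f x + f y) (hsmul : ∀ (r : ℝ) x, f (r • x) = r • f x)
    (hnorm : ∀ x, ‖f x‖ = ‖x‖) (hcard : Fintype.card ι = 2 * (n * Module.finrank ℝ 𝕜)) :
    (stdGaussian (EuclideanSpace ℝ ι)).map f = stdGaussian PairSpace := by
  let L : EuclideanSpace ℝ ι →ₗᵢ[ℝ] PairSpace :=
    { toFun := f, map_add' := hadd, map_smul' := hsmul, norm_map' := hnorm }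
  refine stdGaussian_map (L.toLinearIsometryEquiv ?_)
  rw [finrank_pairSpace, finrank_euclideanSpace, hcard]

end

/-! ### The Hopf map in coordinates -/

lemma hopfSpace_apply {n : ℕ} (q : Fin n → ℍ[ℝ]) (m : Fin n) :
    hopfSpace q m = !₂[(q m).re ^ 2 + (q m).imI ^ 2 - (q m).imJ ^ 2 - (q m).imK ^ 2,
      2 * (q m).imI * (q m).imJ - 2 * (q m).re * (q m).imK,
      2 * (q m).re * (q m).imJ + 2 * (q m).imI * (q m).imK] := by
  obtain ⟨h1, h2, h3⟩ := hopf_coord (q m)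
  rw [hopfSpace, h1, h2, h3]

lemma hopfPlane_sheetOne_apply {n : ℕ} (a b : Fin n → ℝ) (m : Fin n) :
    hopfPlane (sheetOne a b) m = !₂[a m ^ 2 - b m ^ 2, 2 * a m * b m] := by
  obtain ⟨h1, -, h3⟩ := hopf_coord (sheetOne a b m)
  rw [hopfPlane, h1, h3]
  simp [sheetOne]

lemma continuous_hopfSpace {X : Type*} [TopologicalSpace X] {n : ℕ} {q : X → Fin n → ℍ[ℝ]}
    (h0 : ∀ m, Continuous fun x => (q x m).re) (h1 : ∀ m, Continuous fun x => (q x m).imI)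
    (h2 : ∀ m, Continuous fun x => (q x m).imJ) (h3 : ∀ m, Continuous fun x => (q x m).imK) :
    Continuous fun x => hopfSpace (q x) := by
  refine continuous_pi fun m => ?_
  have := h0 m
  have := h1 m
  have := h2 m
  have := h3 m
  simp only [hopfSpace_apply]
  refine (PiLp.continuous_toLp 2 _).comp (continuous_pi fun l => ?_)
  fin_cases l <;> simp <;> fun_prop

lemma continuous_hopfPlane_sheetOne {X : Type*} [TopologicalSpace X] {n : ℕ} {a b : X → Fin n → ℝ}
    (ha : Continuous a) (hb : Continuous b) :
    Continuous fun x => hopfPlane (sheetOne (a x) (b x)) := by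
  refine continuous_pi fun m => ?_
  simp only [hopfPlane_sheetOne_apply]
  refine (PiLp.continuous_toLp 2 _).comp (continuous_pi fun l => ?_)
  fin_cases l <;> simp <;> fun_prop

lemma hopfSpace_smul {n : ℕ} (r : ℝ) (q : Fin n → ℍ[ℝ]) :
    hopfSpace (r • q) = r ^ 2 • hopfSpace q := by
  funext m
  simp only [Pi.smul_apply, hopfSpace_apply]
  ext l
  fin_cases l <;> simp <;> ring

lemma hopfPlane_sheetOne_smul {n : ℕ} (r : ℝ) (a b : Fin n → ℝ) :
    hopfPlane (sheetOne (r • a) (r • b)) = r ^ 2 • hopfPlane (sheetOne a b) := by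
  funext m
  simp only [Pi.smul_apply, hopfPlane_sheetOne_apply]
  ext l
  fin_cases l <;> simp <;> ring

/-- The coordinates of the closing vector are `‖u‖ ^ 2 - ‖v‖ ^ 2`, `-2 Im ⟪u, v⟫` and `2 Re ⟪u, v⟫`.
-/
lemma norm_sum_hopfSpace {n : ℕ} (u v : EuclideanSpace ℂ (Fin n)) :
    ‖∑ m, hopfSpace (complexPair u v) m‖ =
      √((‖u‖ ^ 2 - ‖v‖ ^ 2) ^ 2 + 4 * ‖inner ℂ u v‖ ^ 2) := by
  have hn : ∀ w : EuclideanSpace ℂ (Fin n), ‖w‖ ^ 2 = ∑ m, ((w m).re ^ 2 + (w m).im ^ 2) := by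
    intro w
    rw [EuclideanSpace.norm_sq_eq]
    simp [Complex.sq_norm, Complex.normSq_apply, ← sq]
  have hre : (inner ℂ u v).re = ∑ m, ((u m).re * (v m).re + (u m).im * (v m).im) := by
    simp [PiLp.inner_apply, mul_comm]
  have him : (inner ℂ u v).im = ∑ m, ((u m).re * (v m).im - (u m).im * (v m).re) := by
    simp only [PiLp.inner_apply, Complex.im_sum]
    refine Finset.sum_congr rfl fun m _ => ?_
    simp
    ring
  rw [EuclideanSpace.norm_eq, Complex.sq_norm, Complex.normSq_apply, hn, hn, hre, him,
    Fin.sum_univ_three]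
  congr 1
  simp only [hopfSpace_apply, WithLp.ofLp_sum, Finset.sum_apply, Real.norm_eq_abs, sq_abs]
  rw [← Finset.sum_sub_distrib]
  have h1 : ∑ m, (2 * (complexPair u v m).imI * (complexPair u v m).imJ
      - 2 * (complexPair u v m).re * (complexPair u v m).imK) =
      -2 * ∑ m, ((u m).re * (v m).im - (u m).im * (v m).re) := by
    rw [Finset.mul_sum]
    refine Finset.sum_congr rfl fun m _ => ?_
    simp only [complexPair]
    ring
  have h2 : ∑ m, (2 * (complexPair u v m).re * (complexPair u v m).imJ
      + 2 * (complexPair u v m).imI * (complexPair u v m).imK) =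
      2 * ∑ m, ((u m).re * (v m).re + (u m).im * (v m).im) := by
    rw [Finset.mul_sum]
    refine Finset.sum_congr rfl fun m _ => ?_
    simp only [complexPair]
    ring
  have h0 : ∑ m, ((complexPair u v m).re ^ 2 + (complexPair u v m).imI ^ 2
      - (complexPair u v m).imJ ^ 2 - (complexPair u v m).imK ^ 2) =
      ∑ m, ((u m).re ^ 2 + (u m).im ^ 2 - ((v m).re ^ 2 + (v m).im ^ 2)) := by
    refine Finset.sum_congr rfl fun m _ => ?_
    simp only [complexPair]
    ring
  simp [h0, h1, h2]
  ring

/-- The coordinates of the closing vector are `‖u‖ ^ 2 - ‖v‖ ^ 2` and `2 ⟪u, v⟫`. -/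
lemma norm_sum_hopfPlane_sheetOne {n : ℕ} (u v : EuclideanSpace ℝ (Fin n)) :
    ‖∑ m, hopfPlane (sheetOne u v) m‖ =
      √((‖u‖ ^ 2 - ‖v‖ ^ 2) ^ 2 + 4 * ‖inner ℝ u v‖ ^ 2) := by
  have hi : inner ℝ u v = ∑ m, u m * v m := by
    simp [PiLp.inner_apply, mul_comm]
  have h2 : ∑ m, 2 * u m * v m = 2 * ∑ m, u m * v m := by
    simp only [Finset.mul_sum, mul_assoc]
  rw [EuclideanSpace.norm_eq, EuclideanSpace.norm_sq_eq, EuclideanSpace.norm_sq_eq, hi,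
    Fin.sum_univ_two, ← Finset.sum_sub_distrib]
  congr 1
  simp only [hopfPlane_sheetOne_apply, WithLp.ofLp_sum, Finset.sum_apply, Real.norm_eq_abs, sq_abs]
  simp [h2]
  ring

/-! ### Real coordinates -/

lemma quat_smul {n : ℕ} (r : ℝ) (x : EuclideanSpace ℝ (Fin n × Fin 4)) :
    quat (r • x) = r • quat x := by
  funext m
  ext <;> simp [quat] <;> rfl

lemma complexPair_smul {n : ℕ} (r : ℝ) (u v : EuclideanSpace ℂ (Fin n)) :
    complexPair (r • u) (r • v) = r • complexPair u v := by
  funext m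
  ext <;> simp [complexPair] <;> rfl

/-- The pair of complex vectors with given real coordinates. -/
noncomputable def toComplexPair {n : ℕ} (x : EuclideanSpace ℝ (Fin n × Fin 4)) :
    WithLp 2 (EuclideanSpace ℂ (Fin n) × EuclideanSpace ℂ (Fin n)) :=
  WithLp.toLp 2 (WithLp.toLp 2 fun m => ⟨x (m, 0), x (m, 1)⟩,
    WithLp.toLp 2 fun m => ⟨x (m, 2), x (m, 3)⟩)

/-- The pair of real vectors with given coordinates. -/
noncomputable def toRealPair {n : ℕ} (x : EuclideanSpace ℝ (Fin n × Fin 2)) :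
    WithLp 2 (EuclideanSpace ℝ (Fin n) × EuclideanSpace ℝ (Fin n)) :=
  WithLp.toLp 2 (WithLp.toLp 2 fun m => x (m, 0), WithLp.toLp 2 fun m => x (m, 1))

lemma norm_toComplexPair {n : ℕ} (x : EuclideanSpace ℝ (Fin n × Fin 4)) :
    ‖toComplexPair x‖ = ‖x‖ := by
  rw [← sq_eq_sq₀ (norm_nonneg _) (norm_nonneg _), WithLp.prod_norm_sq_eq_of_L2,
    EuclideanSpace.norm_sq_eq, EuclideanSpace.norm_sq_eq, EuclideanSpace.norm_sq_eq,
    Fintype.sum_prod_type, ← Finset.sum_add_distrib]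
  refine Finset.sum_congr rfl fun m _ => ?_
  simp [toComplexPair, Complex.sq_norm, Complex.normSq_apply, Fin.sum_univ_four]
  ring

lemma norm_toRealPair {n : ℕ} (x : EuclideanSpace ℝ (Fin n × Fin 2)) :
    ‖toRealPair x‖ = ‖x‖ := by
  rw [← sq_eq_sq₀ (norm_nonneg _) (norm_nonneg _), WithLp.prod_norm_sq_eq_of_L2,
    EuclideanSpace.norm_sq_eq, EuclideanSpace.norm_sq_eq, EuclideanSpace.norm_sq_eq,
    Fintype.sum_prod_type, ← Finset.sum_add_distrib]
  refine Finset.sum_congr rfl fun m _ => ?_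
  simp [toRealPair, Fin.sum_univ_two]

lemma toComplexPair_add {n : ℕ} (x y : EuclideanSpace ℝ (Fin n × Fin 4)) :
    toComplexPair (x + y) = toComplexPair x + toComplexPair y := rfl

lemma toRealPair_add {n : ℕ} (x y : EuclideanSpace ℝ (Fin n × Fin 2)) :
    toRealPair (x + y) = toRealPair x + toRealPair y := rfl

lemma toRealPair_smul {n : ℕ} (r : ℝ) (x : EuclideanSpace ℝ (Fin n × Fin 2)) :
    toRealPair (r • x) = r • toRealPair x := rfl

lemma stdGaussian_map_toComplexPair (n : ℕ) :
    (stdGaussian (EuclideanSpace ℝ (Fin n × Fin 4))).map toComplexPair =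
      stdGaussian (WithLp 2 (EuclideanSpace ℂ (Fin n) × EuclideanSpace ℂ (Fin n))) := by
  refine stdGaussian_map_pair (𝕜 := ℂ) toComplexPair_add (fun r x => ?_) norm_toComplexPair ?_
  · refine WithLp.ofLp_injective 2 (Prod.ext ?_ ?_) <;>
    · refine PiLp.ext fun m => ?_
      apply Complex.ext <;> simp [toComplexPair]
  · simp
    ring

lemma stdGaussian_map_toRealPair (n : ℕ) :
    (stdGaussian (EuclideanSpace ℝ (Fin n × Fin 2))).map toRealPair =
      stdGaussian (WithLp 2 (EuclideanSpace ℝ (Fin n) × EuclideanSpace ℝ (Fin n))) := by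
  refine stdGaussian_map_pair (𝕜 := ℝ) toRealPair_add toRealPair_smul norm_toRealPair ?_
  simp
  ring

lemma continuous_hopfSpace_quat (n : ℕ) :
    Continuous fun x : EuclideanSpace ℝ (Fin n × Fin 4) => hopfSpace (quat x) := by
  refine continuous_hopfSpace (fun m => ?_) (fun m => ?_) (fun m => ?_) (fun m => ?_) <;>
  · simp only [quat]
    fun_prop

lemma continuous_hopfSpace_complexPair (n : ℕ) :
    Continuous fun x : WithLp 2 (EuclideanSpace ℂ (Fin n) × EuclideanSpace ℂ (Fin n)) =>
      hopfSpace (complexPair x.fst x.snd) := by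
  have h1 : ∀ m, Continuous fun x : WithLp 2 (EuclideanSpace ℂ (Fin n) × EuclideanSpace ℂ (Fin n)) =>
      x.fst m := fun m => by fun_prop
  have h2 : ∀ m, Continuous fun x : WithLp 2 (EuclideanSpace ℂ (Fin n) × EuclideanSpace ℂ (Fin n)) =>
      x.snd m := fun m => by fun_prop
  exact continuous_hopfSpace (fun m => Complex.continuous_re.comp (h1 m))
    (fun m => Complex.continuous_im.comp (h1 m)) (fun m => Complex.continuous_re.comp (h2 m))
    (fun m => Complex.continuous_im.comp (h2 m))

lemma continuous_toComplexPair (n : ℕ) : Continuous (toComplexPair (n := n)) := by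
  refine (WithLp.prod_continuous_toLp 2 _ _).comp (Continuous.prodMk ?_ ?_) <;>
  · refine (PiLp.continuous_toLp 2 _).comp (continuous_pi fun m => ?_)
    refine Complex.equivRealProdCLM.symm.continuous.comp (Continuous.prodMk ?_ ?_) <;> fun_prop

lemma continuous_toRealPair (n : ℕ) : Continuous (toRealPair (n := n)) := by
  refine (WithLp.prod_continuous_toLp 2 _ _).comp (Continuous.prodMk ?_ ?_) <;>
  · refine (PiLp.continuous_toLp 2 _).comp (continuous_pi fun m => ?_)
    fun_prop

lemma hopfGaussianSpace_eq (n : ℕ) :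
    hopfGaussianSpace n =
      (stdGaussian (WithLp 2 (EuclideanSpace ℂ (Fin n) × EuclideanSpace ℂ (Fin n)))).map
        fun x => hopfSpace (complexPair x.fst x.snd) := by
  rw [← stdGaussian_map_toComplexPair, Measure.map_map
    (continuous_hopfSpace_complexPair n).measurable (continuous_toComplexPair n).measurable]
  rfl

lemma inv_two_smul_add_self {α : Type*} [MeasurableSpace α] (μ : Measure α) :
    (2⁻¹ : ℝ≥0∞) • (μ + μ) = μ := by
  rw [← two_smul ℝ≥0∞ μ, smul_smul, ENNReal.inv_mul_cancel (by norm_num) (by norm_num), one_smul]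

/-- The sheets differ by left multiplication by `i`, which does not change `q̄ i q`, so the two
halves coincide. -/
lemma hopfGaussianPlane_eq (n : ℕ) :
    hopfGaussianPlane n = (stdGaussian (EuclideanSpace ℝ (Fin n × Fin 2))).map
      fun z => hopfPlane (sheetOne (fun m => z (m, 0)) (fun m => z (m, 1))) := by
  simp only [hopfGaussianPlane, hopfPlane_sheetTwo, inv_two_smul_add_self]

lemma continuous_hopfPlane_pair (n : ℕ) :
    Continuous fun x : WithLp 2 (EuclideanSpace ℝ (Fin n) × EuclideanSpace ℝ (Fin n)) =>
      hopfPlane (sheetOne x.fst x.snd) :=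
  continuous_hopfPlane_sheetOne (by fun_prop) (by fun_prop)

lemma hopfGaussianPlane_eq_map_pair (n : ℕ) :
    hopfGaussianPlane n =
      (stdGaussian (WithLp 2 (EuclideanSpace ℝ (Fin n) × EuclideanSpace ℝ (Fin n)))).map
        fun x => hopfPlane (sheetOne x.fst x.snd) := by
  rw [hopfGaussianPlane_eq, ← stdGaussian_map_toRealPair, Measure.map_map
    (continuous_hopfPlane_pair n).measurable (continuous_toRealPair n).measurable]
  rfl

lemma symmetricArmPlane_eq (n : ℕ) :
    symmetricArmPlane n = (uniformSphere (Fin n × Fin 2)).map (sphereToArmPlaneOne n) := by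
  have h : sphereToArmPlaneTwo n = sphereToArmPlaneOne n :=
    funext fun x => Subtype.ext (hopfPlane_sheetTwo _ _)
  rw [symmetricArmPlane, h, inv_two_smul_add_self]

lemma symmetricPolPlane_eq {n : ℕ} (hn : 2 ≤ n) :
    symmetricPolPlane hn = (stiefelHaar ℝ hn).map (stiefelToPolPlaneOne n) := by
  have h : stiefelToPolPlaneTwo n = stiefelToPolPlaneOne n :=
    funext fun x => Subtype.ext (Subtype.ext (hopfPlane_sheetTwo _ _))
  rw [symmetricPolPlane, h, inv_two_smul_add_self]

/-! ### Open and closed polygons, in space and in the plane -/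

theorem integral_hopfGaussianSpace {n : ℕ} (hn : 1 ≤ n) {F : Arms 3 n → ℝ}
    (hF : ScaleInvariant F) :
    (Integrable F (hopfGaussianSpace n) ↔
      Integrable (fun e : Arm 3 n => F e) (symmetricArmSpace n)) ∧
    ∫ e, F e ∂(hopfGaussianSpace n) = ∫ e : Arm 3 n, F e ∂(symmetricArmSpace n) := by
  have : Nonempty (Fin n × Fin 4) := ⟨⟨0, hn⟩, 0⟩
  -- `uniformSphere` and `sphereProb` unfold to the same measure.
  exact arm_of_quadratic (continuous_hopfSpace_quat n).measurable
    (fun r x => by rw [quat_smul, hopfSpace_smul]) (fun x => rfl) hF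

theorem integral_hopfGaussianPlane {n : ℕ} (hn : 1 ≤ n) {F : Arms 2 n → ℝ}
    (hF : ScaleInvariant F) :
    (Integrable F (hopfGaussianPlane n) ↔
      Integrable (fun e : Arm 2 n => F e) (symmetricArmPlane n)) ∧
    ∫ e, F e ∂(hopfGaussianPlane n) = ∫ e : Arm 2 n, F e ∂(symmetricArmPlane n) := by
  have : Nonempty (Fin n × Fin 2) := ⟨⟨0, hn⟩, 0⟩
  rw [hopfGaussianPlane_eq, symmetricArmPlane_eq]
  have hc : Continuous fun z : EuclideanSpace ℝ (Fin n × Fin 2) =>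
      hopfPlane (sheetOne (fun m => z (m, 0)) (fun m => z (m, 1))) :=
    continuous_hopfPlane_sheetOne (by fun_prop) (by fun_prop)
  refine arm_of_quadratic hc.measurable (fun r x => ?_) (fun x => rfl) hF
  rw [← hopfPlane_sheetOne_smul]
  rfl

theorem integral_subspaceMeasure_hopfGaussianSpace {n : ℕ} (hn : 2 ≤ n) :
    IsSubspaceMeasure (hopfGaussianSpace n) (subspaceMeasure (hopfGaussianSpace n)) ∧
    ∀ F : Polygons 3 n → ℝ, ScaleInvariant F →
      (Integrable F (subspaceMeasure (hopfGaussianSpace n)) ↔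
        Integrable (fun p : Pol 3 n => F p) (symmetricPolSpace hn)) ∧
      ∫ p, F p ∂(subspaceMeasure (hopfGaussianSpace n)) =
        ∫ p : Pol 3 n, F p ∂(symmetricPolSpace hn) := by
  refine pol_of_quadratic (𝕜 := ℂ) hn ?_ (continuous_hopfSpace_complexPair n) (fun r x => ?_)
    (fun x => ?_) (fun p => rfl) (hopfGaussianSpace_eq n)
  -- The condition reads `3 < 2 * n`, which is `n ≥ 2`.
  · rw [Complex.finrank_real_complex]
    omega
  · rw [← hopfSpace_smul, ← complexPair_smul]
    rfl
  · exact norm_sum_hopfSpace x.fst x.snd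

theorem integral_subspaceMeasure_hopfGaussianPlane {n : ℕ} (hn : 3 ≤ n) (hn2 : 2 ≤ n) :
    IsSubspaceMeasure (hopfGaussianPlane n) (subspaceMeasure (hopfGaussianPlane n)) ∧
    ∀ F : Polygons 2 n → ℝ, ScaleInvariant F →
      (Integrable F (subspaceMeasure (hopfGaussianPlane n)) ↔
        Integrable (fun p : Pol 2 n => F p) (symmetricPolPlane hn2)) ∧
      ∫ p, F p ∂(subspaceMeasure (hopfGaussianPlane n)) =
        ∫ p : Pol 2 n, F p ∂(symmetricPolPlane hn2) := by
  rw [symmetricPolPlane_eq]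
  refine pol_of_quadratic (𝕜 := ℝ) hn2 ?_ (continuous_hopfPlane_pair n) (fun r x => ?_)
    (fun x => norm_sum_hopfPlane_sheetOne _ _) (fun p => rfl) (hopfGaussianPlane_eq_map_pair n)
  -- The condition reads `2 < n`; this is where the planar case needs `n ≥ 3`.
  · rw [Module.finrank_self]
    omega
  · exact hopfPlane_sheetOne_smul r _ _

end HopfPolygon

theorem theorem2 (n : ℕ) :
    (1 ≤ n → ∀ F : HopfPolygon.Arms 3 n → ℝ, HopfPolygon.ScaleInvariant F →
      (Integrable F (HopfPolygon.hopfGaussianSpace n) ↔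
        Integrable (fun e : HopfPolygon.Arm 3 n => F e) (HopfPolygon.symmetricArmSpace n)) ∧
      ∫ e, F e ∂(HopfPolygon.hopfGaussianSpace n) =
        ∫ e : HopfPolygon.Arm 3 n, F e ∂(HopfPolygon.symmetricArmSpace n)) ∧
    (1 ≤ n → ∀ F : HopfPolygon.Arms 2 n → ℝ, HopfPolygon.ScaleInvariant F →
      (Integrable F (HopfPolygon.hopfGaussianPlane n) ↔
        Integrable (fun e : HopfPolygon.Arm 2 n => F e) (HopfPolygon.symmetricArmPlane n)) ∧
      ∫ e, F e ∂(HopfPolygon.hopfGaussianPlane n) =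
        ∫ e : HopfPolygon.Arm 2 n, F e ∂(HopfPolygon.symmetricArmPlane n)) ∧
    (∀ hn : 2 ≤ n,
      HopfPolygon.IsSubspaceMeasure (HopfPolygon.hopfGaussianSpace n)
        (HopfPolygon.subspaceMeasure (HopfPolygon.hopfGaussianSpace n)) ∧
      ∀ F : HopfPolygon.Polygons 3 n → ℝ, HopfPolygon.ScaleInvariant F →
        (Integrable F (HopfPolygon.subspaceMeasure (HopfPolygon.hopfGaussianSpace n)) ↔
          Integrable (fun p : HopfPolygon.Pol 3 n => F p) (HopfPolygon.symmetricPolSpace hn)) ∧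
        ∫ p, F p ∂(HopfPolygon.subspaceMeasure (HopfPolygon.hopfGaussianSpace n)) =
          ∫ p : HopfPolygon.Pol 3 n, F p ∂(HopfPolygon.symmetricPolSpace hn)) ∧
    (∀ hn : 3 ≤ n,
      HopfPolygon.IsSubspaceMeasure (HopfPolygon.hopfGaussianPlane n)
        (HopfPolygon.subspaceMeasure (HopfPolygon.hopfGaussianPlane n)) ∧
      ∀ F : HopfPolygon.Polygons 2 n → ℝ, HopfPolygon.ScaleInvariant F →
        (Integrable F (HopfPolygon.subspaceMeasure (HopfPolygon.hopfGaussianPlane n)) ↔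
          Integrable (fun p : HopfPolygon.Pol 2 n => F p)
            (HopfPolygon.symmetricPolPlane (Nat.le_of_succ_le hn))) ∧
        ∫ p, F p ∂(HopfPolygon.subspaceMeasure (HopfPolygon.hopfGaussianPlane n)) =
          ∫ p : HopfPolygon.Pol 2 n, F p
            ∂(HopfPolygon.symmetricPolPlane (Nat.le_of_succ_le hn))) := by
  exact ⟨fun hn _ hF => HopfPolygon.integral_hopfGaussianSpace hn hF,
    fun hn _ hF => HopfPolygon.integral_hopfGaussianPlane hn hF,
    fun hn => HopfPolygon.integral_subspaceMeasure_hopfGaussianSpace hn,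
    fun hn => HopfPolygon.integral_subspaceMeasure_hopfGaussianPlane hn (Nat.le_of_succ_le hn)⟩
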